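/- For a finite simple undirected graph $H$, let $d_H(x,y)$ be the number of edges of a shortest path between $x$ and $y$, and let $H^2$ be the graph on the same vertex set in which $x$ and $y$ are adjacent if and only if $1\le d_H(x,y)\le 2$. The girth of $H$ is the length of a shortest cycle, and $\infty$ if $H$ has no cycles. For a graph $G$, let $n$ be its number of vertices and $\delta=\delta(G)$ its minimum degree. **Theorem.** The problem "given a finite graph $G$, does there exist a graph $H$ of girth at least $6$ such that $G=H^2$?" is solvable in polynomial time, and on connected graphs in time $O(\delta\cdot n^4)$. Precisely: there is a single algorithm that, given the adjacency matrix of a finite graph $G$, decides on a random access machine with words of $O(\log n)$ bits (where each addition, truncated subtraction, multiplication, copy, memory access and test is one step) whether $G$ is the square of some graph of girth at least $6$; there is an absolute constant $C$ such that the algorithm takes at most $C(n^5+1)$ steps on every graph $G$ with $n$ vertices, and at most $C\,\delta\, n^4$ steps if $G$ is connected and $n\ge 2$. -/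

import Mathlib

/-- The `k`-th power of a graph: `x` and `y` are adjacent iff `1 ≤ d(x, y) ≤ k`. -/
def graphPower {V : Type*} (H : SimpleGraph V) (k : ℕ) : SimpleGraph V where
  Adj x y := 1 ≤ H.edist x y ∧ H.edist x y ≤ (k : ℕ∞)
  symm := ⟨fun x y h => by rwa [SimpleGraph.edist_comm] at h⟩
  loopless := ⟨fun x h => by simp at h⟩

/-- `G` is the square of some graph of girth at least six (girth is `∞` for acyclic graphs). -/
def IsSquareOfGirthAtLeastSix {V : Type*} (G : SimpleGraph V) : Prop :=
  ∃ H : SimpleGraph V, 6 ≤ H.egirth ∧ G = graphPower H 2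

namespace RAM

/-! A word RAM with structured programs. A program refers to finitely many registers by fixed
names; the memory is an array that is addressed through registers. -/

/-- A machine state: the contents of the registers and of the memory cells. -/
structure State where
  reg : ℕ → ℕ
  mem : ℕ → ℕ

/-- The value that one elementary instruction can compute; `a`, `b` are names of registers. -/
inductive Operation where
  /-- a literal -/
  | const (k : ℕ)
  | copy (a : ℕ)
  | add (a b : ℕ)
  /-- truncated subtraction -/
  | sub (a b : ℕ)
  | mul (a b : ℕ)
  /-- the content of the memory cell whose address is in register `a` -/
  | load (a : ℕ)

def Operation.value : Operation → State → ℕ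
  | const k, _ => k
  | copy a, s => s.reg a
  | add a b, s => s.reg a + s.reg b
  | sub a b, s => s.reg a - s.reg b
  | mul a b, s => s.reg a * s.reg b
  | load a, s => s.mem (s.reg a)

/-- Programs. -/
inductive Program where
  | skip
  /-- write the result of an operation to register `r` -/
  | assign (r : ℕ) (e : Operation)
  /-- write register `r` to the memory cell whose address is in register `a` -/
  | store (a r : ℕ)
  | seq (p q : Program)
  /-- execute `p` if register `r` is nonzero, and `q` otherwise -/
  | cond (r : ℕ) (p q : Program)
  /-- execute `p` as long as register `r` is nonzero -/
  | loop (r : ℕ) (p : Program)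

/-- `Run W p s t s'`: on a machine whose words hold the numbers `0, …, W`, the program `p`, started
in the state `s`, halts in the state `s'` after exactly `t` steps. Each operation, memory access and
test is one step. A program that computes a number larger than `W` is stuck: it has no run. -/
inductive Run (W : ℕ) : Program → State → ℕ → State → Prop where
  | skip (s : State) : Run W .skip s 1 s
  | assign (s : State) (r : ℕ) (e : Operation) (h : e.value s ≤ W) :
      Run W (.assign r e) s 1 { s with reg := Function.update s.reg r (e.value s) }
  | store (s : State) (a r : ℕ) :
      Run W (.store a r) s 1 { s with mem := Function.update s.mem (s.reg a) (s.reg r) }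
  | seq {p q : Program} {s s' s'' : State} {t t' : ℕ}
      (hp : Run W p s t s') (hq : Run W q s' t' s'') : Run W (.seq p q) s (t + t') s''
  | cond_nonzero {r : ℕ} {p q : Program} {s s' : State} {t : ℕ} (hr : s.reg r ≠ 0)
      (hp : Run W p s t s') : Run W (.cond r p q) s (1 + t) s'
  | cond_zero {r : ℕ} {p q : Program} {s s' : State} {t : ℕ} (hr : s.reg r = 0)
      (hq : Run W q s t s') : Run W (.cond r p q) s (1 + t) s'
  | loop_zero {r : ℕ} {p : Program} {s : State} (hr : s.reg r = 0) : Run W (.loop r p) s 1 s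
  | loop_nonzero {r : ℕ} {p : Program} {s s' s'' : State} {t t' : ℕ} (hr : s.reg r ≠ 0)
      (hp : Run W p s t s') (hl : Run W (.loop r p) s' t' s'') :
      Run W (.loop r p) s (1 + t + t') s''

open Classical in
/-- The input: register `0` holds the number `n` of vertices, the memory holds the adjacency matrix
row by row (cell `i * n + j` is `1` if `i` and `j` are adjacent), and everything else is `0`. -/
noncomputable def graphInput {n : ℕ} (G : SimpleGraph (Fin n)) : State where
  reg r := if r = 0 then n else 0
  mem a := if ∃ i j : Fin n, G.Adj i j ∧ a = (i : ℕ) * n + (j : ℕ) then 1 else 0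

/-- With words of at most `W`, on input `G`, the program `p` halts after exactly `t` steps and
answers the question whether `Q` holds: register `0` is then `1` for yes and `0` for no. -/
def AnswersIn (W : ℕ) (p : Program) {n : ℕ} (G : SimpleGraph (Fin n)) (Q : Prop) (t : ℕ) : Prop :=
  ∃ s : State, Run W p (graphInput G) t s ∧
    (s.reg 0 = 1 ∧ Q ∨ s.reg 0 = 0 ∧ ¬ Q)

end RAM

/-! In a root `H` of girth at least six, one neighbourhood determines the whole component. If `t u`
is an edge of `H`, every common `G`-neighbour of `t` and `u` is `H`-adjacent to exactly one of them,
because a vertex at distance two from both would close a five-cycle (`adj_or_adj`). So `N_H(u)` can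
be read off from `G` and `N_H(t)` (`adj_iff_of_adj`), and knowledge spreads along the edges of `H`.

The first neighbourhood needs only a small guess. For an edge `x y` of `H`, the common
`G`-neighbours split into `N_H(x) \ {y}` and `N_H(y) \ {x}`, two cliques of `G` with no `G`-edge
between them (`not_adj_across`). Hence `y`, any common neighbour `w`, and one bit telling the side
of `w` determine `N_H(x)`. For given `x` this leaves `deg_G x` candidates for `y` and two bits.

Wrong guesses are harmless: each candidate matrix is verified on its component (`IsRootOn`), and
verified matrices glue to a root of `G` (`exists_isRoot`). Guessing, spreading and verifying take
`O(n^3)` steps. They are done only from vertices of least degree in their component; there are at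
most `n` of these, each with `δ` neighbours if `G` is connected. This gives `δ n^4`, and
reachability costs another `n^4`.

For the machine, the algorithm is written in a small language of loops over Boolean matrices with a
functional semantics and an explicit step count. The compiler is verified once
(`Expr.compile_evaluates`, `Prog.compile_reach`), including that all values fit into words. The
graph argument then concerns `eval` only, and the time bound `cost` only. -/

namespace RAM

/-! ### Countdown loops and timed reasoning about machine programs -/

/-- The result of running `f` on the indices `k - 1, …, 0`. -/
def forFin {n : ℕ} {α : Type} (f : Fin n → α → α) : (k : ℕ) → k ≤ n → α → α
  | 0, _, a => a
  | k + 1, h, a => forFin f k (Nat.le_of_succ_le h) (f ⟨k, h⟩ a)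

/-- The cost of the countdown loop that computes `forFin f k`, where `c` is the cost of a round. -/
def forCost {n : ℕ} {α : Type} (f : Fin n → α → α) (c : Fin n → α → ℕ) :
    (k : ℕ) → k ≤ n → α → ℕ
  | 0, _, _ => 1
  | k + 1, h, a => 1 + c ⟨k, h⟩ a + forCost f c k (Nat.le_of_succ_le h) (f ⟨k, h⟩ a)

theorem forFin_sum {n : ℕ} (g : Fin n → ℕ) (k : ℕ) (h : k ≤ n) (a : ℕ) :
    forFin (fun i a => a + g i) k h a = a + ∑ i : Fin k, g (Fin.castLE h i) := by
  induction k generalizing a with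
  | zero => simp [forFin]
  | succ k ih =>
    rw [forFin, ih, Fin.sum_univ_castSucc]
    have : g ⟨k, h⟩ = g (Fin.castLE h (Fin.last k)) := rfl
    rw [this]
    simp only [Fin.castLE_castSucc]
    ring

/-- The index of the invariant counts the rounds still to come: in `I k` the indices from `k` on
have been treated. -/
theorem forFin_invariant {n : ℕ} {α : Type} (f : Fin n → α → α) (I : ℕ → α → Prop)
    (step : ∀ (i : Fin n) a, I (i + 1) a → I i (f i a)) (k : ℕ) (h : k ≤ n) (a : α) (ha : I k a) :
    I 0 (forFin f k h a) := by
  induction k generalizing a with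
  | zero => exact ha
  | succ k ih => exact ih _ _ (step ⟨k, h⟩ a ha)

/-- The bound of a round may depend on its index. This is what later lets only the neighbours of a
vertex, and not all `n` vertices, pay for a test. -/
theorem forCost_le {n : ℕ} {α : Type} (f : Fin n → α → α) (c : Fin n → α → ℕ) (I : α → Prop)
    (step : ∀ i a, I a → I (f i a)) (B : Fin n → ℕ) (hB : ∀ i a, I a → c i a ≤ B i)
    (k : ℕ) (h : k ≤ n) (a : α) (ha : I a) :
    forCost f c k h a ≤ 1 + ∑ i : Fin k, (1 + B (Fin.castLE h i)) := by
  induction k generalizing a with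
  | zero => simp [forCost]
  | succ k ih =>
    rw [forCost, Fin.sum_univ_castSucc]
    have h1 := ih (Nat.le_of_succ_le h) _ (step ⟨k, h⟩ a ha)
    have h2 := hB ⟨k, h⟩ a ha
    have h3 : B ⟨k, h⟩ = B (Fin.castLE h (Fin.last k)) := rfl
    rw [h3] at h2
    simp only [Fin.castLE_castSucc]
    omega

theorem forCost_le_const {n : ℕ} {α : Type} (f : Fin n → α → α) (c : Fin n → α → ℕ) (B : ℕ)
    (hB : ∀ i a, c i a ≤ B) (a : α) : forCost f c n le_rfl a ≤ 1 + n * (1 + B) := by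
  simpa using forCost_le f c (fun _ => True) (by simp) (fun _ => B) (fun i a _ => hB i a) n le_rfl a
    trivial

/-- The register of a variable. -/
def var (x : ℕ) : ℕ := 2 * x + 2

/-- The auxiliary registers. -/
def tmp (d : ℕ) : ℕ := 2 * d + 1

@[simp] theorem var_ne_zero (x : ℕ) : var x ≠ 0 := by unfold var; omega
@[simp] theorem zero_ne_var (x : ℕ) : 0 ≠ var x := by unfold var; omega
@[simp] theorem zero_ne_tmp (x : ℕ) : 0 ≠ tmp x := by unfold tmp; omega
@[simp] theorem var_ne_tmp (x d : ℕ) : var x ≠ tmp d := by unfold var tmp; omega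
@[simp] theorem tmp_ne_var (x d : ℕ) : tmp d ≠ var x := by unfold var tmp; omega
@[simp] theorem var_inj (x y : ℕ) : var x = var y ↔ x = y := by unfold var; omega
@[simp] theorem tmp_inj (x y : ℕ) : tmp x = tmp y ↔ x = y := by unfold tmp; omega

/-- Write `v` to register `r`. -/
def State.set (s : State) (r v : ℕ) : State := { s with reg := Function.update s.reg r v }

@[simp] theorem State.set_mem (s : State) (r v : ℕ) : (s.set r v).mem = s.mem := rfl

theorem State.set_reg (s : State) (r v q : ℕ) :
    (s.set r v).reg q = if q = r then v else s.reg q := by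
  simp [State.set, Function.update_apply]

/-- `p` halts within `T` steps in a state with `Q`. -/
def Reach (W : ℕ) (p : Program) (s : State) (T : ℕ) (Q : State → Prop) : Prop :=
  ∃ t s', Run W p s t s' ∧ t ≤ T ∧ Q s'

theorem Reach.mono {W : ℕ} {p : Program} {s : State} {T T' : ℕ} {Q Q' : State → Prop}
    (h : Reach W p s T Q) (hT : T ≤ T') (hQ : ∀ s', Q s' → Q' s') : Reach W p s T' Q' := by
  obtain ⟨t, s', hr, ht, hq⟩ := h
  exact ⟨t, s', hr, ht.trans hT, hQ _ hq⟩

theorem Reach.skip {W : ℕ} {s : State} {Q : State → Prop} (hQ : Q s) : Reach W .skip s 1 Q :=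
  ⟨1, s, .skip s, le_rfl, hQ⟩

theorem Reach.assign {W : ℕ} {s : State} {Q : State → Prop} {r : ℕ} {e : Operation}
    (h : e.value s ≤ W) (hQ : Q (s.set r (e.value s))) : Reach W (.assign r e) s 1 Q :=
  ⟨1, _, .assign s r e h, le_rfl, hQ⟩

theorem Reach.store {W : ℕ} {s : State} {Q : State → Prop} {a r : ℕ}
    (hQ : Q { s with mem := Function.update s.mem (s.reg a) (s.reg r) }) :
    Reach W (.store a r) s 1 Q :=
  ⟨1, _, .store s a r, le_rfl, hQ⟩

theorem Reach.seq {W : ℕ} {p q : Program} {s : State} {T T' : ℕ} {Q : State → Prop}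
    (h : Reach W p s T (fun s' => Reach W q s' T' Q)) : Reach W (.seq p q) s (T + T') Q := by
  obtain ⟨t, s', hr, ht, t', s'', hr', ht', hQ⟩ := h
  exact ⟨_, _, .seq hr hr', by omega, hQ⟩

theorem Reach.assign_seq {W : ℕ} {p : Program} {s : State} {T : ℕ} {Q : State → Prop} {r : ℕ}
    {e : Operation} (h : e.value s ≤ W) (hp : Reach W p (s.set r (e.value s)) T Q) :
    Reach W (.seq (.assign r e) p) s (1 + T) Q :=
  Reach.seq (Reach.assign h hp)

theorem Reach.cond {W : ℕ} {p q : Program} {s : State} {T : ℕ} {Q : State → Prop} {r : ℕ}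
    (h : s.reg r ≠ 0 → Reach W p s T Q) (h' : s.reg r = 0 → Reach W q s T Q) :
    Reach W (.cond r p q) s (1 + T) Q := by
  by_cases hr : s.reg r = 0
  · obtain ⟨t, s', hr', ht, hq⟩ := h' hr
    exact ⟨_, _, .cond_zero hr hr', by omega, hq⟩
  · obtain ⟨t, s', hr', ht, hq⟩ := h hr
    exact ⟨_, _, .cond_nonzero hr hr', by omega, hq⟩

/-- The countdown loop that runs `p` with variable `x` equal to `n - 1, …, 0`. -/
def forProgram (d x : ℕ) (p : Program) : Program :=
  .seq (.assign (tmp d) (.copy 0)) <| .seq (.assign (tmp (d + 1)) (.copy (var x))) <|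
  .seq (.loop (tmp d)
    (.seq (.assign (tmp (d + 2)) (.const 1)) <|
     .seq (.assign (tmp d) (.sub (tmp d) (tmp (d + 2)))) <|
     .seq (.assign (var x) (.copy (tmp d))) p))
  (.assign (var x) (.copy (tmp (d + 1))))

/-- `D k a s` ties the machine state to the functional value `a` with `k` rounds left. It must be
blind to the loop's own registers (`hD`), and the body must preserve the counter `tmp d` and the
saved variable `tmp (d + 1)`; `tmp (d + 2)` holds the constant 1 and is reloaded in every round. -/
theorem Reach.countdown {n W : ℕ} {α : Type} {d x : ℕ} {p : Program} (hn : n < W)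
    (f : Fin n → α → α) (c : Fin n → α → ℕ) (D : ℕ → α → State → Prop)
    (hD : ∀ k a s r v, D k a s → (r = var x ∨ ∃ d' ≥ d, r = tmp d') → D k a (s.set r v))
    (hp : ∀ (i : Fin n) a s, D (i + 1) a s → s.reg (var x) = i →
      Reach W p s (c i a) (fun s' => D i (f i a) s' ∧ s'.reg (tmp d) = s.reg (tmp d) ∧
        s'.reg (tmp (d + 1)) = s.reg (tmp (d + 1))))
    (k : ℕ) (hk : k ≤ n) (a : α) (s : State) (h : D k a s) (hs : s.reg (tmp d) = k) :
    Reach W (.loop (tmp d)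
      (.seq (.assign (tmp (d + 2)) (.const 1)) <|
       .seq (.assign (tmp d) (.sub (tmp d) (tmp (d + 2)))) <|
       .seq (.assign (var x) (.copy (tmp d))) p)) s
      (forCost f (fun i a => 3 + c i a) k hk a)
      (fun s' => D 0 (forFin f k hk a) s' ∧ s'.reg (tmp (d + 1)) = s.reg (tmp (d + 1))) := by
  induction k generalizing a s with
  | zero => exact ⟨1, s, .loop_zero hs, le_rfl, h, rfl⟩
  | succ k ih =>
    have key : Reach W
      (.seq (.assign (tmp (d + 2)) (.const 1)) <|
       .seq (.assign (tmp d) (.sub (tmp d) (tmp (d + 2)))) <|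
       .seq (.assign (var x) (.copy (tmp d))) p) s (1 + (1 + (1 + c ⟨k, hk⟩ a)))
       (fun s' => D k (f ⟨k, hk⟩ a) s' ∧ s'.reg (tmp d) = k ∧
        s'.reg (tmp (d + 1)) = s.reg (tmp (d + 1))) := by
      refine .assign_seq (by simp only [Operation.value]; omega) <| .assign_seq ?_ <|
        .assign_seq ?_ <| (hp ⟨k, hk⟩ a _ ?_ ?_).mono le_rfl ?_
      · simp [Operation.value, State.set_reg, hs]; omega
      · simp [Operation.value, State.set_reg, hs]; omega
      · refine hD _ _ _ _ _ (hD _ _ _ _ _ (hD _ _ _ _ _ h ?_) ?_) ?_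
        · exact .inr ⟨d + 2, by omega, rfl⟩
        · exact .inr ⟨d, le_rfl, rfl⟩
        · exact .inl rfl
      · simp [Operation.value, State.set_reg, hs]
      · rintro s' ⟨h1, h2, h3⟩
        refine ⟨h1, ?_, ?_⟩
        · rw [h2]; simp [Operation.value, State.set_reg, hs]
        · rw [h3]; simp [State.set_reg]
    obtain ⟨t, s', hr, ht, h1, h2, h3⟩ := key
    obtain ⟨t', s'', hr', ht', h1', h2'⟩ := ih (Nat.le_of_succ_le hk) _ s' h1 h2
    refine ⟨_, _, .loop_nonzero (by omega) hr hr', ?_, h1', h2'.trans h3⟩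
    rw [forCost]
    omega

theorem Reach.forProgram {n W : ℕ} {α : Type} {d x : ℕ} {p : Program} (hn : n < W)
    (f : Fin n → α → α) (c : Fin n → α → ℕ) (D : ℕ → α → State → Prop)
    (hD : ∀ k a s r v, D k a s → (r = var x ∨ ∃ d' ≥ d, r = tmp d') → D k a (s.set r v))
    (hp : ∀ (i : Fin n) a s, D (i + 1) a s → s.reg (var x) = i →
      Reach W p s (c i a) (fun s' => D i (f i a) s' ∧ s'.reg (tmp d) = s.reg (tmp d) ∧
        s'.reg (tmp (d + 1)) = s.reg (tmp (d + 1))))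
    (a : α) (s : State) (h : D n a s) (hs : s.reg 0 = n) (hx : s.reg (var x) ≤ W) :
    Reach W (forProgram d x p) s (1 + (1 + (forCost f (fun i a => 3 + c i a) n le_rfl a + 1)))
      (fun s' => D 0 (forFin f n le_rfl a) s' ∧ s'.reg (var x) = s.reg (var x)) := by
  refine .assign_seq (by simp only [Operation.value]; omega) <| .assign_seq ?_ <| .seq <|
    (Reach.countdown hn f c D hD hp n le_rfl a _ ?_ ?_).mono le_rfl ?_
  · simpa [Operation.value, State.set_reg] using hx
  · refine hD _ _ _ _ _ (hD _ _ _ _ _ h ?_) ?_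
    · exact .inr ⟨d, le_rfl, rfl⟩
    · exact .inr ⟨d + 1, by omega, rfl⟩
  · simp [Operation.value, State.set_reg, hs]
  · rintro s' ⟨h1, h2⟩
    have h3 : s'.reg (tmp (d + 1)) = s.reg (var x) := by
      rw [h2]; simp [Operation.value, State.set_reg]
    refine .assign (by simpa only [Operation.value, h3] using hx) ⟨hD _ _ _ _ _ h1 (.inl rfl), ?_⟩
    simp [Operation.value, State.set_reg, h3]

/-! ### Arithmetic expressions and their compilation -/

/-- Boolean matrices, numbered by `ℕ`. -/
abbrev Arrays (n : ℕ) : Type := ℕ → Fin n → Fin n → Bool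

/-- Expressions. The variables hold vertices. -/
inductive Expr where
  | num (k : ℕ)
  /-- the entry of array `k` in row `x` and column `y` -/
  | cell (k x y : ℕ)
  | eq (x y : ℕ)
  | add (a b : Expr)
  | sub (a b : Expr)
  | mul (a b : Expr)
  /-- the sum of `e` over all values of variable `x` -/
  | sum (x : ℕ) (e : Expr)

namespace Expr

def eval {n : ℕ} (A : Arrays n) : Expr → (ℕ → Fin n) → ℕ
  | num k, _ => k
  | cell k x y, ρ => (A k (ρ x) (ρ y)).toNat
  | eq x y, ρ => if ρ x = ρ y then 1 else 0
  | add a b, ρ => a.eval A ρ + b.eval A ρ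
  | sub a b, ρ => a.eval A ρ - b.eval A ρ
  | mul a b, ρ => a.eval A ρ * b.eval A ρ
  | sum x e, ρ => ∑ i, e.eval A (Function.update ρ x i)

/-- The values that occur in the evaluation are at most `(n + 2) ^ width`. -/
def width : Expr → ℕ
  | num k => k + 1
  -- The entry is at most 1; it is its address, below `(k + 1) * n ^ 2`, that needs this exponent.
  | cell k _ _ => k + 3
  | eq _ _ => 1
  | add a b => a.width + b.width + 1
  | sub a b => a.width + b.width
  | mul a b => a.width + b.width
  | sum _ e => e.width + 1

/-- In a sum, each round has one test, three assignments that update counter and variable, and one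
addition. The other 5 steps clear the accumulator, set up the loop (two), make the last test and
restore the variable. -/
def cost (n : ℕ) : Expr → ℕ
  | num _ => 1
  | cell _ _ _ => 6
  | eq _ _ => 5
  | add a b => a.cost n + (b.cost n + 1)
  | sub a b => a.cost n + (b.cost n + 1)
  | mul a b => a.cost n + (b.cost n + 1)
  | sum _ e => 5 + n * (e.cost n + 5)

theorem width_pos (e : Expr) : 1 ≤ e.width := by
  induction e <;> simp only [width] <;> omega

theorem eval_le {n : ℕ} (A : Arrays n) (e : Expr) (ρ : ℕ → Fin n) :
    e.eval A ρ ≤ (n + 2) ^ e.width := by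
  have pos : ∀ m, 1 ≤ (n + 2) ^ m := fun m => Nat.one_le_pow _ _ (by omega)
  induction e generalizing ρ with
  | num k =>
    calc k ≤ 2 ^ (k + 1) := (Nat.lt_two_pow_self.trans (Nat.pow_lt_pow_right (by norm_num) (by omega))).le
      _ ≤ _ := Nat.pow_le_pow_left (by omega) _
  | cell k x y => exact (Bool.toNat_le _).trans (pos _)
  | eq x y => simp only [eval]; split_ifs <;> [exact pos _; omega]
  | add a b iha ihb =>
    simp only [eval, width]
    have ha := iha ρ
    have hb := ihb ρ
    have h1 : (n + 2) ^ a.width ≤ (n + 2) ^ (a.width + b.width) :=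
      Nat.pow_le_pow_right (by omega) (by omega)
    have h2 : (n + 2) ^ b.width ≤ (n + 2) ^ (a.width + b.width) :=
      Nat.pow_le_pow_right (by omega) (by omega)
    rw [pow_succ]
    nlinarith [pos (a.width + b.width)]
  | sub a b iha ihb =>
    simp only [eval, width]
    exact (Nat.sub_le _ _).trans ((iha ρ).trans (Nat.pow_le_pow_right (by omega) (by omega)))
  | mul a b iha ihb =>
    simp only [eval, width, pow_add]
    exact Nat.mul_le_mul (iha ρ) (ihb ρ)
  | sum x e ih =>
    simp only [eval, width]
    calc _ ≤ ∑ i : Fin n, (n + 2) ^ e.width := Finset.sum_le_sum fun i _ => ih _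
      _ = n * (n + 2) ^ e.width := by simp
      _ ≤ _ := by rw [pow_succ, mul_comm]; exact Nat.mul_le_mul_left _ (by omega)

end Expr

/-- The address of the entry in row `x` and column `y` of array `k`, followed by `q`. -/
def addressThen (d k x y : ℕ) (q : Program) : Program :=
  .seq (.assign (tmp d) (.const k)) <| .seq (.assign (tmp d) (.mul (tmp d) 0)) <|
  .seq (.assign (tmp d) (.add (tmp d) (var x))) <| .seq (.assign (tmp d) (.mul (tmp d) 0)) <|
  .seq (.assign (tmp d) (.add (tmp d) (var y))) q

/-- The program that writes the value of an expression to `tmp d`. -/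
def Expr.compile : ℕ → Expr → Program
  | d, .num k => .assign (tmp d) (.const k)
  | d, .cell k x y => addressThen d k x y (.assign (tmp d) (.load (tmp d)))
  | d, .eq x y =>
    -- The two truncated differences add up to the distance of the values, and `1 - ·` turns this
    -- into the indicator of equality.
    .seq (.assign (tmp d) (.sub (var x) (var y))) <|
    .seq (.assign (tmp (d + 1)) (.sub (var y) (var x))) <|
    .seq (.assign (tmp d) (.add (tmp d) (tmp (d + 1)))) <|
    .seq (.assign (tmp (d + 1)) (.const 1)) <|
    .assign (tmp d) (.sub (tmp (d + 1)) (tmp d))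
  | d, .add a b =>
    .seq (a.compile d) <| .seq (b.compile (d + 1)) <| .assign (tmp d) (.add (tmp d) (tmp (d + 1)))
  | d, .sub a b =>
    .seq (a.compile d) <| .seq (b.compile (d + 1)) <| .assign (tmp d) (.sub (tmp d) (tmp (d + 1)))
  | d, .mul a b =>
    .seq (a.compile d) <| .seq (b.compile (d + 1)) <| .assign (tmp d) (.mul (tmp d) (tmp (d + 1)))
  | d, .sum x e =>
    .seq (.assign (tmp d) (.const 0)) <| forProgram (d + 1) x <|
    .seq (e.compile (d + 3)) <| .assign (tmp d) (.add (tmp d) (tmp (d + 3)))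

/-- The state `s` represents the values `ρ` of the variables and the arrays `A`. -/
structure Represents {n : ℕ} (ρ : ℕ → Fin n) (A : Arrays n) (s : State) : Prop where
  zero : s.reg 0 = n
  var : ∀ x, s.reg (var x) = ρ x
  mem : ∀ k (i j : Fin n), s.mem ((k * n + i) * n + j) = (A k i j).toNat

/-- The auxiliary registers before `d` agree. -/
def SameBelow (d : ℕ) (s s' : State) : Prop := ∀ d' < d, s'.reg (tmp d') = s.reg (tmp d')

theorem Represents.set_tmp {n : ℕ} {ρ : ℕ → Fin n} {A : Arrays n} {s : State}
    (h : Represents ρ A s) (d v : ℕ) : Represents ρ A (s.set (tmp d) v) where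
  zero := by simp [State.set_reg, h.zero]
  var x := by simp [State.set_reg, h.var]
  mem := h.mem

theorem Represents.set_var {n : ℕ} {ρ : ℕ → Fin n} {A : Arrays n} {s : State}
    (h : Represents ρ A s) (x : ℕ) (i : Fin n) :
    Represents (Function.update ρ x i) A (s.set (RAM.var x) i) where
  zero := by simp [State.set_reg, h.zero]
  var y := by
    by_cases hy : y = x
    · subst hy; simp [State.set_reg]
    · simp [State.set_reg, hy, h.var]
  mem := h.mem

/-- `s` represents `ρ` and `A`, apart from the value of the variable `x`. -/
structure RepresentsExcept {n : ℕ} (x : ℕ) (ρ : ℕ → Fin n) (A : Arrays n) (s : State) : Prop where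
  zero : s.reg 0 = n
  var : ∀ y ≠ x, s.reg (var y) = ρ y
  mem : ∀ k (i j : Fin n), s.mem ((k * n + i) * n + j) = (A k i j).toNat

theorem RepresentsExcept.represents {n : ℕ} {x : ℕ} {ρ : ℕ → Fin n} {A : Arrays n} {s : State}
    (h : RepresentsExcept x ρ A s) {i : Fin n} (hi : s.reg (RAM.var x) = i) :
    Represents (Function.update ρ x i) A s where
  zero := h.zero
  var y := by
    by_cases hy : y = x
    · subst hy; simpa using hi
    · simp [hy, h.var]
  mem := h.mem

theorem Represents.except {n : ℕ} {x : ℕ} {ρ : ℕ → Fin n} {A : Arrays n} {s : State} {i : Fin n}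
    (h : Represents (Function.update ρ x i) A s) : RepresentsExcept x ρ A s where
  zero := h.zero
  var y hy := by simp [h.var, hy]
  mem := h.mem

theorem RepresentsExcept.set {n : ℕ} {x : ℕ} {ρ : ℕ → Fin n} {A : Arrays n} {s : State}
    (h : RepresentsExcept x ρ A s) {r : ℕ} (hr : r = RAM.var x ∨ ∃ d, r = tmp d) (v : ℕ) :
    RepresentsExcept x ρ A (s.set r v) where
  zero := by rcases hr with rfl | ⟨d, rfl⟩ <;> simp [State.set_reg, h.zero]
  var y hy := by rcases hr with rfl | ⟨d, rfl⟩ <;> simp [State.set_reg, h.var, hy]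
  mem := h.mem

theorem Represents.to_except {n : ℕ} {x : ℕ} {ρ : ℕ → Fin n} {A : Arrays n} {s : State}
    (h : Represents ρ A s) : RepresentsExcept x ρ A s :=
  ⟨h.zero, fun y _ => h.var y, h.mem⟩

theorem RepresentsExcept.to_represents {n : ℕ} {x : ℕ} {ρ : ℕ → Fin n} {A : Arrays n} {s : State}
    (h : RepresentsExcept x ρ A s) (hx : s.reg (RAM.var x) = ρ x) : Represents ρ A s := by
  simpa using h.represents hx

theorem SameBelow.set {d : ℕ} {s s' : State} (h : SameBelow d s s') {d' : ℕ} (hd : d ≤ d') (v : ℕ) :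
    SameBelow d s (s'.set (tmp d') v) := fun e he => by
  rw [← h e he]; simp [State.set_reg]; omega

theorem SameBelow.set_var {d : ℕ} {s s' : State} (h : SameBelow d s s') (x v : ℕ) :
    SameBelow d s (s'.set (var x) v) := fun e he => by
  rw [← h e he]; simp [State.set_reg]

theorem SameBelow.trans {d : ℕ} {s s' s'' : State} (h : SameBelow d s s') (h' : SameBelow d s' s'') :
    SameBelow d s s'' := fun e he => (h' e he).trans (h e he)

theorem SameBelow.mono {d d' : ℕ} {s s' : State} (h : SameBelow d s s') (hd : d' ≤ d) :
    SameBelow d' s s' := fun e he => h e (by omega)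

theorem SameBelow.refl (d : ℕ) (s : State) : SameBelow d s s := fun _ _ => rfl

theorem Reach.addressThen {n W : ℕ} {ρ : ℕ → Fin n} {A : Arrays n} {d k x y : ℕ} {s : State}
    (h : Represents ρ A s) (hW : (n + 2) ^ (k + 3) ≤ W) {q : Program} {T : ℕ} {Q : State → Prop}
    (hq : ∀ s', Represents ρ A s' → SameBelow d s s' → s'.mem = s.mem →
      s'.reg (tmp d) = (k * n + ρ x) * n + ρ y → Reach W q s' T Q) :
    Reach W (addressThen d k x y q) s (5 + T) Q := by
  have hk : (k + 1) * (n * n) ≤ W := by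
    refine le_trans ?_ hW
    rw [pow_add]
    refine Nat.mul_le_mul ?_ ?_
    · exact (Nat.lt_two_pow_self).trans_le (Nat.pow_le_pow_left (by omega) _)
    · nlinarith
  have hk' : k ≤ W := by
    refine le_trans ?_ hW
    exact (Nat.lt_two_pow_self (n := k)).le.trans ((Nat.pow_le_pow_left (by omega) _).trans
      (Nat.pow_le_pow_right (by omega) (by omega)))
  have hx := (ρ x).isLt
  have hy := (ρ y).isLt
  have e1 : k * n + ρ x ≤ (k + 1) * n := by nlinarith
  have e2 : (k * n + ρ x) * n ≤ W := by nlinarith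
  have e3 : (k * n + ρ x) * n + ρ y ≤ W := by
    have : (k * n + ρ x) * n + ρ y < (k * n + ρ x + 1) * n := by nlinarith
    have : (k * n + ρ x + 1) * n ≤ (k + 1) * n * n := Nat.mul_le_mul_right _ (by nlinarith)
    nlinarith
  have e0 : k * n + ρ x ≤ W := by nlinarith
  have e4 : k * n ≤ W := by omega
  have key : Reach W (RAM.addressThen d k x y q) s (1 + (1 + (1 + (1 + (1 + T))))) Q := by
    refine .assign_seq ?_ <| .assign_seq ?_ <| .assign_seq ?_ <| .assign_seq ?_ <|
      .assign_seq ?_ <| hq _ ?_ ?_ rfl ?_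
    · simpa [Operation.value] using hk'
    · simpa [Operation.value, State.set_reg, h.zero] using e4
    · simpa [Operation.value, State.set_reg, h.zero, h.var] using e0
    · simpa [Operation.value, State.set_reg, h.zero, h.var] using e2
    · simpa [Operation.value, State.set_reg, h.zero, h.var] using e3
    · exact ((((h.set_tmp _ _).set_tmp _ _).set_tmp _ _).set_tmp _ _).set_tmp _ _
    · exact ((((SameBelow.refl _ _).set le_rfl _ |>.set le_rfl _).set le_rfl _).set le_rfl _).set
        le_rfl _
    · simp [Operation.value, State.set_reg, h.zero, h.var]
  exact key.mono (by omega) fun _ h => h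

/-- In states that represent `ρ` and `A`, the program `p` writes `v` to `tmp d` within `T` steps and
changes nothing else but the auxiliary registers from `d` on. -/
def Evaluates {n : ℕ} (W : ℕ) (ρ : ℕ → Fin n) (A : Arrays n) (d : ℕ) (p : Program) (T v : ℕ) :
    Prop :=
  ∀ s, Represents ρ A s → Reach W p s T fun s' =>
    Represents ρ A s' ∧ SameBelow d s s' ∧ s'.mem = s.mem ∧ s'.reg (tmp d) = v

theorem Evaluates.binary {n W : ℕ} {ρ : ℕ → Fin n} {A : Arrays n} {d T T' v v' : ℕ} {p q : Program}
    (hp : Evaluates W ρ A d p T v) (hq : Evaluates W ρ A (d + 1) q T' v') (o : ℕ → ℕ → Operation)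
    (g : ℕ → ℕ → ℕ) (ho : ∀ a b s, (o a b).value s = g (s.reg a) (s.reg b)) (hg : g v v' ≤ W) :
    Evaluates W ρ A d (.seq p (.seq q (.assign (tmp d) (o (tmp d) (tmp (d + 1))))))
      (T + (T' + 1)) (g v v') := by
  intro s h
  refine .seq <| (hp s h).mono le_rfl ?_
  rintro s1 ⟨h1, h2, h3, h4⟩
  refine .seq <| (hq s1 h1).mono le_rfl ?_
  rintro s2 ⟨k1, k2, k3, k4⟩
  have hv : (o (tmp d) (tmp (d + 1))).value s2 = g v v' := by
    rw [ho, k4, k2 d (by omega), h4]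
  refine .assign (by rwa [hv]) ⟨k1.set_tmp _ _, ?_, ?_, ?_⟩
  · exact (h2.trans (k2.mono (by omega))).set le_rfl _
  · simp [k3, h3]
  · simp [State.set_reg, hv]

/-- The auxiliary registers form a stack: at depth `d` nothing below `tmp d` is touched, so pending
partial results survive. In a sum, the body may start at `d + 3` although the loop uses that
register, since the loop keeps nothing there across the body. -/
theorem Expr.compile_evaluates {n W : ℕ} (A : Arrays n) (e : Expr) (ρ : ℕ → Fin n) (d : ℕ)
    (hW : (n + 2) ^ e.width ≤ W) : Evaluates W ρ A d (e.compile d) (e.cost n) (e.eval A ρ) := by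
  have hle := (e.eval_le A ρ).trans hW
  have hmono : ∀ {m : ℕ}, m ≤ e.width → (n + 2) ^ m ≤ W := fun hm =>
    (Nat.pow_le_pow_right (by omega) hm).trans hW
  have hn : n + 2 ≤ W := by simpa using hmono e.width_pos
  clear hW
  induction e generalizing ρ d with
  | num k =>
    intro s h
    exact .assign hle ⟨h.set_tmp _ _, (SameBelow.refl _ _).set le_rfl _, rfl, by
      simp [State.set_reg, Operation.value, Expr.eval]⟩
  | cell k x y =>
    intro s h
    refine .addressThen (T := 1) h (hmono le_rfl) fun s' h1 h2 h3 h4 => ?_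
    have hv : (Operation.load (tmp d)).value s' = (A k (ρ x) (ρ y)).toNat := by
      simp only [Operation.value, h4, h1.mem]
    refine .assign (by rw [hv]; exact hle) ⟨h1.set_tmp _ _, h2.set le_rfl _, h3, ?_⟩
    simp only [State.set_reg, hv, Expr.eval]; simp
  | eq x y =>
    intro s h
    have hx := (ρ x).isLt
    have hy := (ρ y).isLt
    have key : Reach W ((Expr.eq x y).compile d) s (1 + (1 + (1 + (1 + 1)))) fun s' =>
        Represents ρ A s' ∧ SameBelow d s s' ∧ s'.mem = s.mem ∧
          s'.reg (tmp d) = (Expr.eq x y).eval A ρ := by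
      refine .assign_seq ?_ <| .assign_seq ?_ <| .assign_seq ?_ <| .assign_seq ?_ <|
        .assign ?_ ⟨?_, ?_, rfl, ?_⟩
      · simp [Operation.value, h.var]; omega
      · simp [Operation.value, State.set_reg, h.var]; omega
      · simp [Operation.value, State.set_reg, h.var]; omega
      · simp [Operation.value]; omega
      · simp [Operation.value, State.set_reg, h.var]; omega
      · exact ((((h.set_tmp _ _).set_tmp _ _).set_tmp _ _).set_tmp _ _).set_tmp _ _
      · exact (((((SameBelow.refl _ _).set le_rfl _).set (Nat.le_succ d) _).set le_rfl _).set
          (Nat.le_succ d) _).set le_rfl _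
      · simp only [Operation.value, State.set_reg, h.var, Expr.eval, Fin.ext_iff]
        simp
        split_ifs <;> omega
    exact key
  | add a b iha ihb =>
    exact (iha _ _ ((a.eval_le A ρ).trans (hmono (by simp only [width]; omega)))
        fun hm => hmono (by simp only [width]; omega)).binary
      (ihb _ _ ((b.eval_le A ρ).trans (hmono (by simp only [width]; omega)))
        fun hm => hmono (by simp only [width]; omega)) Operation.add (· + ·) (fun _ _ _ => rfl) hle
  | sub a b iha ihb =>
    exact (iha _ _ ((a.eval_le A ρ).trans (hmono (by simp only [width]; omega)))
        fun hm => hmono (by simp only [width]; omega)).binary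
      (ihb _ _ ((b.eval_le A ρ).trans (hmono (by simp only [width]; omega)))
        fun hm => hmono (by simp only [width]; omega)) Operation.sub (· - ·) (fun _ _ _ => rfl) hle
  | mul a b iha ihb =>
    exact (iha _ _ ((a.eval_le A ρ).trans (hmono (by simp only [width]; omega)))
        fun hm => hmono (by simp only [width]; omega)).binary
      (ihb _ _ ((b.eval_le A ρ).trans (hmono (by simp only [width]; omega)))
        fun hm => hmono (by simp only [width]; omega)) Operation.mul (· * ·) (fun _ _ _ => rfl) hle
  | sum x e ih =>
    intro s h
    have hsum : ∀ i, e.eval A (Function.update ρ x i) ≤ W := fun i =>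
      (e.eval_le A _).trans (hmono (by simp only [width]; omega))
    set B := (n + 2) ^ e.width with hB
    have hnB : n * B ≤ W := le_trans (by rw [width, pow_succ, mul_comm]; gcongr; omega) (hmono le_rfl)
    have heB : ∀ i, e.eval A (Function.update ρ x i) ≤ B := fun i => e.eval_le A _
    have key := Reach.assign_seq (e := .const 0) (Nat.zero_le W) <|
      (Reach.forProgram (W := W) (d := d + 1) (x := x)
        (p := .seq (e.compile (d + 3)) (.assign (tmp d) (.add (tmp d) (tmp (d + 3)))))
        (by omega : n < W)
        (fun i a => a + e.eval A (Function.update ρ x i)) (fun _ _ => e.cost n + 1)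
        -- The last conjunct keeps the accumulator within a word: the partial sum plus the most that
        -- the remaining `k` rounds can add is at most `W`.
        (fun k a s' => RepresentsExcept x ρ A s' ∧ SameBelow d s s' ∧
          s'.mem = s.mem ∧ s'.reg (tmp d) = a ∧ a + k * B ≤ W)
        ?_ ?_ 0 (s.set (tmp d) 0) ?_ ?_ ?_).mono
        (T' := 1 + (1 + (1 + n * (1 + (3 + (e.cost n + 1))) + 1))) (Q' := fun s' =>
          Represents ρ A s' ∧ SameBelow d s s' ∧ s'.mem = s.mem ∧
          s'.reg (tmp d) = (sum x e).eval A ρ) ?_ ?_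
    · exact Reach.mono key (by simp only [cost]; ring_nf; rfl) fun _ h => h
    · rintro k a s' r v ⟨h1, h2, h3, h4, h5⟩ (rfl | ⟨d', hd', rfl⟩)
      · exact ⟨h1.set (.inl rfl) _, h2.set_var _ _, h3, by simpa [State.set_reg] using h4, h5⟩
      · exact ⟨h1.set (.inr ⟨_, rfl⟩) _, h2.set (by omega) _, h3, by
          rw [State.set_reg, if_neg (by simp; omega), h4], h5⟩
    · rintro i a s' ⟨h1, h2, h3, h4, h5⟩ hi
      refine .seq <| (ih (Function.update ρ x i) (d + 3) (hsum i)
        (fun hm => hmono (by simp only [width]; omega)) s' (h1.represents hi)).mono le_rfl ?_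
      rintro s'' ⟨k1, k2, k3, k4⟩
      have hv : (Operation.add (tmp d) (tmp (d + 3))).value s'' =
          a + e.eval A (Function.update ρ x i) := by
        simp only [Operation.value, k4, k2 d (by omega), h4]
      have h6 : a + e.eval A (Function.update ρ x i) + i * B ≤ W := by
        have := heB i
        rw [Nat.add_mul] at h5
        omega
      refine .assign (by rw [hv]; omega) ⟨⟨k1.except.set (.inr ⟨_, rfl⟩) _, ?_, ?_, ?_, h6⟩, ?_, ?_⟩
      · exact (h2.trans (k2.mono (by omega))).set le_rfl _
      · simp [k3, h3]
      · simp [State.set_reg, hv]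
      · rw [State.set_reg, if_neg (by simp), k2 _ (by omega)]
      · rw [State.set_reg, if_neg (by simp; omega), k2 _ (by omega)]
    · exact ⟨(h.set_tmp _ _).to_except, (SameBelow.refl _ _).set le_rfl _, rfl, by
        simp [State.set_reg], by simpa using hnB⟩
    · simp [State.set_reg, h.zero]
    · have := (ρ x).isLt
      simp [State.set_reg, h.var]; omega
    · have := forCost_le_const (fun (i : Fin n) a => a + e.eval A (Function.update ρ x i))
        (fun _ _ => 3 + (e.cost n + 1)) _ (fun _ _ => le_rfl) 0
      omega
    · rintro s' ⟨⟨h1, h2, h3, h4, -⟩, h5⟩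
      refine ⟨h1.to_represents ?_, h2, h3, ?_⟩
      · rw [h5]; simp [State.set_reg, h.var]
      · rw [h4, forFin_sum]; simp [eval]

/-! ### Programs on Boolean matrices and their compilation -/

/-- Programs on Boolean matrices. The variables are bound by `each` and `pick`, which restore
their values. -/
inductive Prog where
  /-- write to the entry of array `k` in row `x` and column `y` whether `e` is nonzero -/
  | write (k x y : ℕ) (e : Expr)
  | seq (p q : Prog)
  /-- execute `p` if `e` is nonzero -/
  | when (e : Expr) (p : Prog)
  /-- execute `p` for all values of variable `x` -/
  | each (x : ℕ) (p : Prog)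
  /-- execute `p` for one value of variable `x` such that `e` is nonzero, if there is any -/
  | pick (x : ℕ) (e : Expr) (p : Prog)

/-- Some index for which `g` is nonzero. -/
def find {n : ℕ} (g : Fin n → ℕ) : Option (Fin n) :=
  forFin (fun i o => if g i ≠ 0 then some i else o) n le_rfl none

theorem find_spec {n : ℕ} (g : Fin n → ℕ) :
    (find g = none ∧ ∀ i, g i = 0) ∨ ∃ i, find g = some i ∧ g i ≠ 0 := by
  have key := forFin_invariant (fun i o => if g i ≠ 0 then some i else o)
    (fun k o => (o = none ∧ ∀ i : Fin n, k ≤ i → g i = 0) ∨ ∃ i, o = some i ∧ g i ≠ 0) ?_ n le_rfl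
    none (.inl ⟨rfl, fun i hi => absurd i.isLt (by omega)⟩)
  · exact key.imp_left fun h => ⟨h.1, fun i => h.2 i (Nat.zero_le _)⟩
  · rintro i a h
    by_cases hi : g i = 0
    · simp only [hi, ne_eq, not_true_eq_false, if_false]
      refine h.imp_left fun h => ⟨h.1, fun j hj => ?_⟩
      rcases hj.eq_or_lt with hj | hj
      · rwa [← Fin.ext hj]
      · exact h.2 j hj
    · exact .inr ⟨i, by simp [hi], hi⟩

namespace Prog

def eval {n : ℕ} : Prog → (ℕ → Fin n) → Arrays n → Arrays n
  | write k x y e, ρ, A => fun k' i j =>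
    if k' = k ∧ i = ρ x ∧ j = ρ y then decide (e.eval A ρ ≠ 0) else A k' i j
  | seq p q, ρ, A => q.eval ρ (p.eval ρ A)
  | when e p, ρ, A => if e.eval A ρ ≠ 0 then p.eval ρ A else A
  | each x p, ρ, A => forFin (fun i A => p.eval (Function.update ρ x i) A) n le_rfl A
  | pick x e p, ρ, A =>
    (find fun i => e.eval A (Function.update ρ x i)).elim A
      fun i => p.eval (Function.update ρ x i) A

/-- Unlike the cost of an expression, this depends on the data: the body of `when` is charged only
if it is executed, which is the source of the factor `δ`. -/
def cost {n : ℕ} : Prog → (ℕ → Fin n) → Arrays n → ℕ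
  | write _ _ _ e, _, _ => e.cost n + 9
  | seq p q, ρ, A => p.cost ρ A + q.cost ρ (p.eval ρ A)
  | when e p, ρ, A => e.cost n + 2 + if e.eval A ρ ≠ 0 then p.cost ρ A else 0
  | each x p, ρ, A => 3 + forCost (fun i A => p.eval (Function.update ρ x i) A)
      (fun i A => 3 + p.cost (Function.update ρ x i) A) n le_rfl A
  | pick x e p, ρ, A => 12 + n * (e.cost n + 7) +
    (find fun i => e.eval A (Function.update ρ x i)).elim 0
      fun i => p.cost (Function.update ρ x i) A

/-- The values that occur in the execution are at most `(n + 2) ^ width`. -/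
def width : Prog → ℕ
  | write k _ _ e => k + 3 + e.width
  | seq p q => p.width + q.width
  | when e p => e.width + p.width
  | each _ p => p.width
  | pick _ e p => e.width + p.width

theorem width_pos (p : Prog) : 1 ≤ p.width := by
  induction p <;> simp only [width] <;> omega

/-- `write` replaces `v` by `1 - (1 - v)` to normalise it to 0 or 1. `pick` records `i + 1` in `tmp
d`, so that 0 means that nothing was found; after decoding, `tmp d` is reused to save the old value
of the variable. -/
def compile : ℕ → Prog → Program
  | d, write k x y e =>
    .seq (e.compile d) <|
    .seq (.assign (tmp (d + 1)) (.const 1)) <|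
    .seq (.assign (tmp d) (.sub (tmp (d + 1)) (tmp d))) <|
    .seq (.assign (tmp d) (.sub (tmp (d + 1)) (tmp d))) <|
    addressThen (d + 1) k x y (.store (tmp (d + 1)) (tmp d))
  | d, seq p q => .seq (p.compile d) (q.compile d)
  | d, when e p => .seq (e.compile d) (.cond (tmp d) (p.compile d) .skip)
  | d, each x p => forProgram d x (p.compile (d + 2))
  | d, pick x e p =>
    .seq (.assign (tmp d) (.const 0)) <|
    .seq (forProgram (d + 1) x <|
      .seq (e.compile (d + 3)) <|
      .cond (tmp (d + 3))
        (.seq (.assign (tmp (d + 3)) (.const 1)) (.assign (tmp d) (.add (tmp (d + 3)) (var x))))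
        .skip) <|
    .cond (tmp d)
      (.seq (.assign (tmp (d + 1)) (.const 1)) <|
       .seq (.assign (tmp (d + 1)) (.sub (tmp d) (tmp (d + 1)))) <|
       .seq (.assign (tmp d) (.copy (var x))) <|
       .seq (.assign (var x) (.copy (tmp (d + 1)))) <|
       .seq (p.compile (d + 1)) <|
       .assign (var x) (.copy (tmp d)))
      .skip

/-- Uniqueness of division with remainder, applied twice. Hence a store changes exactly one entry of
one array. -/
theorem address_inj {n k k' : ℕ} {i j i' j' : Fin n} :
    (k * n + i) * n + j = (k' * n + i') * n + j' ↔ k = k' ∧ i = i' ∧ j = j' := by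
  have aux : ∀ (a b : ℕ) (i j : Fin n), a * n + i = b * n + j → a = b ∧ i = j := by
    intro a b i j h
    have hn := i.pos
    have h1 := congrArg (· % n) h
    simp only [Nat.mul_add_mod_self_right, Nat.mod_eq_of_lt i.isLt, Nat.mod_eq_of_lt j.isLt] at h1
    refine ⟨?_, Fin.ext h1⟩
    rw [h1] at h
    exact Nat.eq_of_mul_eq_mul_right hn (Nat.add_right_cancel h)
  constructor
  · intro h
    obtain ⟨h1, h2⟩ := aux _ _ _ _ h
    obtain ⟨h3, h4⟩ := aux _ _ _ _ h1
    exact ⟨h3, h4, h2⟩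
  · rintro ⟨rfl, rfl, rfl⟩
    rfl

theorem compile_reach {n W : ℕ} (p : Prog) (ρ : ℕ → Fin n) (A : Arrays n) (d : ℕ)
    (hW : (n + 2) ^ p.width ≤ W) (s : State) (h : Represents ρ A s) :
    Reach W (p.compile d) s (p.cost ρ A)
      fun s' => Represents ρ (p.eval ρ A) s' ∧ SameBelow d s s' := by
  have hmono : ∀ {m : ℕ}, m ≤ p.width → (n + 2) ^ m ≤ W := fun hm =>
    (Nat.pow_le_pow_right (by omega) hm).trans hW
  have hn : n + 2 ≤ W := by simpa using hmono p.width_pos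
  clear hW
  induction p generalizing ρ A d s with
  | write k x y e =>
    have key : Reach W ((write k x y e).compile d) s (e.cost n + (1 + (1 + (1 + (5 + 1)))))
        fun s' => Represents ρ ((write k x y e).eval ρ A) s' ∧ SameBelow d s s' := by
      refine .seq <| (e.compile_evaluates A ρ d (hmono (by simp only [width]; omega)) s h).mono
        le_rfl ?_
      rintro s1 ⟨h1, h2, -, h4⟩
      refine .assign_seq (by simp only [Operation.value]; omega) <| .assign_seq ?_ <|
        .assign_seq ?_ <| .addressThen (ρ := ρ) (A := A) ?_
          (hmono (by have := e.width_pos; simp only [width]; omega)) ?_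
      · simp [Operation.value, State.set_reg]; omega
      · simp [Operation.value, State.set_reg]; omega
      · exact ((h1.set_tmp _ _).set_tmp _ _).set_tmp _ _
      · intro s2 k1 k2 k3 k4
        have hv : s2.reg (tmp d) = (decide (e.eval A ρ ≠ 0)).toNat := by
          rw [k2 d (by omega)]
          by_cases he : e.eval A ρ = 0
          · simp [Operation.value, State.set_reg, h4, he]
          · simp [Operation.value, State.set_reg, h4, he]; omega
        refine .store ⟨⟨k1.zero, k1.var, fun k' i j => ?_⟩, ?_⟩
        · simp only [k4, hv, Function.update_apply, eval, address_inj]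
          split_ifs
          · rfl
          · exact k1.mem k' i j
        · exact (((h2.set (Nat.le_succ d) _).set le_rfl _).set le_rfl _).trans
            (k2.mono (Nat.le_succ d))
    exact key
  | seq p q ihp ihq =>
    refine .seq <| (ihp ρ A d s h fun hm => hmono (by simp only [width]; omega)).mono le_rfl ?_
    rintro s1 ⟨h1, h2⟩
    refine (ihq ρ _ d s1 h1 fun hm => hmono (by simp only [width]; omega)).mono le_rfl ?_
    rintro s2 ⟨k1, k2⟩
    exact ⟨k1, h2.trans k2⟩
  | when e p ih =>
    have key : Reach W ((when e p).compile d) s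
      (e.cost n + (1 + (1 + if e.eval A ρ ≠ 0 then p.cost ρ A else 0)))
      fun s' => Represents ρ ((when e p).eval ρ A) s' ∧ SameBelow d s s' := by
      refine .seq <| (e.compile_evaluates A ρ d (hmono (by simp only [width]; omega)) s h).mono
        le_rfl ?_
      rintro s1 ⟨h1, h2, h3, h4⟩
      refine .cond ?_ ?_
      · rw [h4]
        intro h0
        refine (ih ρ A d s1 h1 fun hm => hmono (by simp only [width]; omega)).mono (by simp [h0]) ?_
        rintro s2 ⟨k1, k2⟩
        exact ⟨by simpa [eval, h0] using k1, h2.trans k2⟩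
      · rw [h4]
        intro h0
        exact (Reach.skip ⟨by simpa [eval, h0] using h1, h2⟩).mono (T := 1) (by omega) fun _ h => h
    exact key.mono (by simp only [cost]; omega) fun _ h => h
  | each x p ih =>
    have key := Reach.forProgram (W := W) (d := d) (x := x) (p := p.compile (d + 2))
        (by omega : n < W) (fun i A => p.eval (Function.update ρ x i) A)
        (fun i A => p.cost (Function.update ρ x i) A)
        (fun _ A s' => RepresentsExcept x ρ A s' ∧ SameBelow d s s') ?_ ?_ A s
        ⟨h.to_except, SameBelow.refl _ _⟩ h.zero ?_
    · refine key.mono (by simp only [cost]; omega) ?_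
      rintro s' ⟨⟨h1, h2⟩, h3⟩
      exact ⟨h1.to_represents (h3.trans (h.var x)), h2⟩
    · rintro k a s' r v ⟨h1, h2⟩ (rfl | ⟨d', hd', rfl⟩)
      · exact ⟨h1.set (.inl rfl) _, h2.set_var _ _⟩
      · exact ⟨h1.set (.inr ⟨_, rfl⟩) _, h2.set hd' _⟩
    · rintro i a s' ⟨h1, h2⟩ hi
      refine (ih (Function.update ρ x i) a (d + 2) s' (h1.represents hi)
        fun hm => hmono (by simp only [width]; omega)).mono le_rfl ?_
      rintro s'' ⟨k1, k2⟩
      exact ⟨⟨k1.except, h2.trans (k2.mono (by omega))⟩, k2 _ (by omega), k2 _ (by omega)⟩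
    · have := (ρ x).isLt
      rw [h.var]; omega
  | pick x e p ih =>
    have hmono' : ∀ {m : ℕ}, m ≤ p.width → (n + 2) ^ m ≤ W := fun hm =>
      hmono (by simp only [width]; omega)
    have hx := (ρ x).isLt
    have hfind := Reach.forProgram (W := W) (d := d + 1) (x := x)
        (p := .seq (e.compile (d + 3)) <| .cond (tmp (d + 3))
          (.seq (.assign (tmp (d + 3)) (.const 1)) (.assign (tmp d) (.add (tmp (d + 3)) (var x))))
          .skip)
        (by omega : n < W)
        (fun i o => if e.eval A (Function.update ρ x i) ≠ 0 then some i else o)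
        (fun _ _ => e.cost n + (1 + 2))
        (fun _ o s' => RepresentsExcept x ρ A s' ∧ SameBelow d s s' ∧
          s'.reg (tmp d) = o.elim 0 fun i => (i : ℕ) + 1) ?_ ?_ none (s.set (tmp d) 0)
        ⟨(h.set_tmp _ _).to_except, (SameBelow.refl _ _).set le_rfl _, by simp [State.set_reg]⟩
        (by simp [State.set_reg, h.zero]) (by simp [State.set_reg, h.var]; omega)
    · have hcost := forCost_le_const
        (fun i o => if e.eval A (Function.update ρ x i) ≠ 0 then some i else o)
        (fun _ _ => 3 + (e.cost n + (1 + 2))) _ (fun _ _ => le_rfl) (none : Option (Fin n))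
      have key : Reach W ((pick x e p).compile d) s
        (1 + (4 + n * (e.cost n + 7) + (1 + (5 +
          (find fun i => e.eval A (Function.update ρ x i)).elim 0
            fun i => p.cost (Function.update ρ x i) A))))
        fun s' => Represents ρ ((pick x e p).eval ρ A) s' ∧ SameBelow d s s' := by
        refine .assign_seq (Nat.zero_le W) <| .seq <| hfind.mono ?_ ?_
        · ring_nf at hcost ⊢
          omega
        · rintro s1 ⟨⟨h1, h2, h3⟩, h4⟩
          rw [State.set_reg, if_neg (by simp)] at h4
          change _ = (find fun i => e.eval A (Function.update ρ x i)).elim _ _ at h3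
          replace h1 := h1.to_represents (h4.trans (h.var x))
          rw [h.var] at h4
          rw [eval]
          cases hf : find fun i => e.eval A (Function.update ρ x i) with
          | none =>
            simp only [hf, Option.elim] at h3 ⊢
            exact .cond (fun h0 => absurd h3 h0) fun _ => (Reach.skip ⟨h1, h2⟩).mono (by omega)
              fun _ h => h
          | some i =>
            simp only [hf, Option.elim] at h3 ⊢
            have hi := i.isLt
            refine .cond (fun _ => ?_) fun h0 => by omega
            have run : Reach W
                (.seq (.assign (tmp (d + 1)) (.const 1)) <|
                 .seq (.assign (tmp (d + 1)) (.sub (tmp d) (tmp (d + 1)))) <|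
                 .seq (.assign (tmp d) (.copy (var x))) <|
                 .seq (.assign (var x) (.copy (tmp (d + 1)))) <|
                 .seq (p.compile (d + 1)) <|
                 .assign (var x) (.copy (tmp d))) s1
                (1 + (1 + (1 + (1 + (p.cost (Function.update ρ x i) A + 1)))))
                fun s' => Represents ρ (p.eval (Function.update ρ x i) A) s' ∧
                  SameBelow d s s' := by
              refine .assign_seq (by simp only [Operation.value]; omega) <| .assign_seq ?_ <|
                .assign_seq ?_ <| .assign_seq ?_ <| .seq <|
                (ih (Function.update ρ x i) A (d + 1) _ ?_ hmono').mono le_rfl ?_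
              · simp [Operation.value, State.set_reg, h3]; omega
              · simp [Operation.value, State.set_reg, h4]; omega
              · simp [Operation.value, State.set_reg, h3]; omega
              · have hv : (i : ℕ) = i + 1 - 1 := by omega
                simpa [Operation.value, State.set_reg, h3, h4] using
                  (((h1.set_tmp (d + 1) 1).set_tmp (d + 1) i).set_tmp d (ρ x)).set_var x i
              · rintro s2 ⟨k1, k2⟩
                have k3 : s2.reg (tmp d) = ρ x := by
                  rw [k2 d (by omega)]
                  simp [Operation.value, State.set_reg, h4]
                refine .assign (by simp only [Operation.value]; omega) ⟨?_, ?_⟩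
                · refine (k1.except.set (.inl rfl) _).to_represents ?_
                  simp [Operation.value, State.set_reg, k3]
                · exact (((((h2.set (Nat.le_succ d) _).set (Nat.le_succ d) _).set le_rfl _).set_var
                    _ _).trans (k2.mono (Nat.le_succ d))).set_var _ _
            exact run.mono (by omega) fun _ h => h
      exact key.mono (by simp only [cost]; omega) fun _ h => h
    · rintro k o s' r v ⟨h1, h2, h3⟩ (rfl | ⟨d', hd', rfl⟩)
      · exact ⟨h1.set (.inl rfl) _, h2.set_var _ _, by simpa [State.set_reg] using h3⟩
      · exact ⟨h1.set (.inr ⟨_, rfl⟩) _, h2.set (by omega) _, by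
          rw [State.set_reg, if_neg (by simp; omega), h3]⟩
    · rintro i o s' ⟨h1, h2, h3⟩ hi
      have hi' := i.isLt
      refine .seq <| (e.compile_evaluates A (Function.update ρ x i) (d + 3)
        (hmono (by simp only [width]; omega)) s' (h1.represents hi)).mono le_rfl ?_
      rintro s1 ⟨k1, k2, -, k4⟩
      have k5 := k2.mono (show d ≤ d + 3 by omega)
      have k6 : s1.reg (var x) = i := by simp [k1.var]
      refine .cond (fun h0 => ?_) fun h0 => ?_
      · rw [k4] at h0
        refine .assign_seq (by simp only [Operation.value]; omega) <| .assign ?_ ⟨⟨?_, ?_, ?_⟩, ?_⟩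
        · simp [Operation.value, State.set_reg, k6]; omega
        · exact (k1.except.set (.inr ⟨_, rfl⟩) _).set (.inr ⟨_, rfl⟩) _
        · exact ((h2.trans k5).set (by omega) _).set le_rfl _
        · simp [Operation.value, State.set_reg, k6, h0]; omega
        · simp only [State.set_reg, tmp_inj]
          constructor
          · rw [if_neg (by omega), if_neg (by omega), k2 _ (by omega)]
          · rw [if_neg (by omega), if_neg (by omega), k2 _ (by omega)]
      · rw [k4] at h0
        refine (Reach.skip ⟨⟨k1.except, h2.trans k5, ?_⟩, k2 _ (by omega), k2 _ (by omega)⟩).mono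
          (by omega) fun _ h => h
        rw [k2 d (by omega), h3]
        simp [h0]

end Prog

end RAM


/-! ### Square roots of girth at least six -/

namespace SimpleGraph

variable {V : Type*}

/-- There are no cycles of length less than six. -/
structure ShortCycleFree (H : SimpleGraph V) : Prop where
  three : ∀ {a b c}, H.Adj a b → H.Adj b c → H.Adj c a → False
  four : ∀ {a b c d}, a ≠ c → b ≠ d → H.Adj a b → H.Adj b c → H.Adj c d → H.Adj d a → False
  five : ∀ {a b c d e}, H.Adj a b → H.Adj b c → H.Adj c d → H.Adj d e → H.Adj e a → False

/-- The five-cycle condition needs no distinctness hypotheses: if two non-consecutive vertices of a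
closed walk of length five coincide, three of its edges form a triangle. -/
theorem six_le_egirth_iff (H : SimpleGraph V) : 6 ≤ H.egirth ↔ H.ShortCycleFree := by
  have le_iff : (6 : ℕ∞) ≤ H.egirth ↔ ∀ a (w : H.Walk a a), w.IsCycle → 6 ≤ w.length := by
    rw [show (6 : ℕ∞) = ((6 : ℕ) : ℕ∞) from rfl, le_egirth]
    simp only [Nat.cast_le]
  rw [le_iff]
  constructor
  · intro h
    have three : ∀ {a b c}, H.Adj a b → H.Adj b c → H.Adj c a → False := by
      intro a b c hab hbc hca
      have := h a (.cons hab (.cons hbc (.cons hca .nil))) (by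
        simp [Walk.cons_isCycle_iff, Walk.cons_isPath_iff, hab.ne, hab.ne', hbc.ne, hca.ne, hca.ne'])
      simp at this
    have four : ∀ {a b c d}, a ≠ c → b ≠ d → H.Adj a b → H.Adj b c → H.Adj c d → H.Adj d a →
        False := by
      intro a b c d hac hbd hab hbc hcd hda
      have := h a (.cons hab (.cons hbc (.cons hcd (.cons hda .nil)))) (by
        simp [Walk.cons_isCycle_iff, Walk.cons_isPath_iff, hab.ne, hab.ne', hbc.ne, hcd.ne,
          hda.ne, hda.ne', hac, hac.symm, hbd])
      simp at this
    refine ⟨three, four, ?_⟩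
    intro a b c d e hab hbc hcd hde hea
    have hac : a ≠ c := by rintro rfl; exact three hcd hde hea
    have hbd : b ≠ d := by rintro rfl; exact three hde hea hab
    have hce : c ≠ e := by rintro rfl; exact three hea hab hbc
    have hda : d ≠ a := by rintro rfl; exact three hab hbc hcd
    have heb : e ≠ b := by rintro rfl; exact three hbc hcd hde
    have := h a (.cons hab (.cons hbc (.cons hcd (.cons hde (.cons hea .nil))))) (by
      simp [Walk.cons_isCycle_iff, Walk.cons_isPath_iff, hab.ne, hab.ne', hbc.ne, hcd.ne,
        hde.ne, hea.ne, hea.ne', hac, hac.symm, hbd, hce, hda, hda.symm, heb.symm])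
    simp at this
  · intro hH a w hw
    by_contra hlt
    have h3 := hw.three_le_length
    match w, hw with
    | .nil, hw => simp at h3
    | .cons _ .nil, _ => simp at h3
    | .cons _ (.cons _ .nil), _ => simp at h3
    | .cons h1 (.cons h2 (.cons h3 .nil)), _ => exact hH.three h1 h2 h3
    | .cons h1 (.cons h2 (.cons h3 (.cons h4 .nil))), hw =>
      have hn := hw.support_nodup
      simp at hn
      exact hH.four (by tauto) (by tauto) h1 h2 h3 h4
    | .cons h1 (.cons h2 (.cons h3 (.cons h4 (.cons h5 .nil)))), _ => exact hH.five h1 h2 h3 h4 h5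
    | .cons _ (.cons _ (.cons _ (.cons _ (.cons _ (.cons _ _))))), _ =>
      simp at hlt

theorem graphPower_two_adj (H : SimpleGraph V) (a b : V) :
    (graphPower H 2).Adj a b ↔ a ≠ b ∧ (H.Adj a b ∨ ∃ c, H.Adj a c ∧ H.Adj c b) := by
  change 1 ≤ H.edist a b ∧ H.edist a b ≤ ((2 : ℕ) : ℕ∞) ↔ _
  rw [Order.one_le_iff_ne_zero, Ne, edist_eq_zero_iff]
  refine and_congr_right fun hab => ⟨fun h => ?_, ?_⟩
  · have hr : H.edist a b ≠ ⊤ := ne_top_of_le_ne_top (ENat.natCast_ne_top _) h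
    obtain ⟨w, hw⟩ := exists_walk_of_edist_ne_top hr
    rw [← hw, Nat.cast_le] at h
    match w with
    | .nil => exact absurd rfl hab
    | .cons h1 .nil => exact .inl h1
    | .cons h1 (.cons h2 .nil) => exact .inr ⟨_, h1, h2⟩
    | .cons _ (.cons _ (.cons _ _)) => simp at h
  · rintro (h | ⟨c, h1, h2⟩)
    · exact (edist_le (Walk.cons h .nil)).trans (by simp)
    · exact (edist_le (Walk.cons h1 (.cons h2 .nil))).trans (by simp)

/-- `H` is a square root of `G` of girth at least six. -/
structure IsRoot (G H : SimpleGraph V) : Prop where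
  free : H.ShortCycleFree
  adj : ∀ a b, G.Adj a b ↔ a ≠ b ∧ (H.Adj a b ∨ ∃ c, H.Adj a c ∧ H.Adj c b)

theorem isSquareOfGirthAtLeastSix_iff (G : SimpleGraph V) :
    IsSquareOfGirthAtLeastSix G ↔ ∃ H, G.IsRoot H := by
  refine exists_congr fun H => ?_
  rw [six_le_egirth_iff]
  constructor
  · rintro ⟨h, rfl⟩
    exact ⟨h, graphPower_two_adj H⟩
  · rintro ⟨h, h'⟩
    refine ⟨h, ?_⟩
    ext a b
    rw [h', graphPower_two_adj]

namespace IsRoot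

variable {G H : SimpleGraph V}

theorem le (h : G.IsRoot H) {a b : V} (hab : H.Adj a b) : G.Adj a b :=
  (h.adj a b).2 ⟨hab.ne, .inl hab⟩

theorem adj_of_common (h : G.IsRoot H) {a b c : V} (hac : H.Adj a c) (hcb : H.Adj c b)
    (hab : a ≠ b) : G.Adj a b :=
  (h.adj a b).2 ⟨hab, .inr ⟨c, hac, hcb⟩⟩

/-- Otherwise `z` has a common `H`-neighbour `p` with `x` and `q` with `y`, and `x y q z p` is a
closed walk of length five. -/
theorem adj_or_adj (h : G.IsRoot H) {x y z : V} (hxy : H.Adj x y) (hxz : G.Adj x z)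
    (hyz : G.Adj y z) : H.Adj x z ∨ H.Adj y z := by
  obtain ⟨-, hx | ⟨p, hp, hp'⟩⟩ := (h.adj x z).1 hxz
  · exact .inl hx
  obtain ⟨-, hy | ⟨q, hq, hq'⟩⟩ := (h.adj y z).1 hyz
  · exact .inr hy
  exact (h.free.five hxy hq hq' hp'.symm hp.symm).elim

/-- The neighbourhood of a vertex is determined by the neighbourhood of a neighbour. -/
theorem adj_iff_of_adj (h : G.IsRoot H) {t u : V} (htu : H.Adj t u) (z : V) :
    H.Adj u z ↔ z = t ∨ G.Adj u z ∧ G.Adj t z ∧ ¬ H.Adj t z := by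
  constructor
  · intro huz
    by_cases hz : z = t
    · exact .inl hz
    · exact .inr ⟨h.le huz, h.adj_of_common htu huz (Ne.symm hz),
        fun htz => h.free.three htu huz htz.symm⟩
  · rintro (rfl | ⟨h1, h2, h3⟩)
    · exact htu.symm
    · exact (h.adj_or_adj htu h2 h1).resolve_left h3

/-- The ends of the path `a x y b` can neither coincide, nor be adjacent, nor have a common
neighbour in `H`: this would close a cycle of length three, four or five. -/
theorem not_adj_across (h : G.IsRoot H) {x y a b : V} (hxy : H.Adj x y) (hxa : H.Adj x a)
    (hyb : H.Adj y b) (hay : a ≠ y) (hbx : b ≠ x) : ¬ (b = a ∨ G.Adj a b) := by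
  rintro (rfl | hab)
  · exact h.free.three hxy hyb hxa.symm
  obtain ⟨-, hab | ⟨p, hp, hp'⟩⟩ := (h.adj a b).1 hab
  · exact h.free.four hbx.symm hay.symm hxy hyb hab.symm hxa.symm
  · exact h.free.five hxy hyb hp'.symm hp.symm hxa.symm

/-- Here `w` lies on the side of `x`. The vertices of that side are pairwise `G`-adjacent through
`x`, and none of them meets the side of `y`, so closeness to `w` recognises them. -/
theorem adj_iff_side (h : G.IsRoot H) {x y w : V} (hxy : H.Adj x y) (hxw : H.Adj x w) (hwy : w ≠ y)
    (z : V) : H.Adj x z ↔ z = y ∨ G.Adj x z ∧ G.Adj y z ∧ (z = w ∨ G.Adj w z) := by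
  constructor
  · intro hxz
    by_cases hzy : z = y
    · exact .inl hzy
    refine .inr ⟨h.le hxz, h.adj_of_common hxy.symm hxz (Ne.symm hzy), ?_⟩
    by_cases hzw : z = w
    · exact .inl hzw
    · exact .inr (h.adj_of_common hxw.symm hxz (Ne.symm hzw))
  · rintro (rfl | ⟨h1, h2, h3⟩)
    · exact hxy
    · exact (h.adj_or_adj hxy h1 h2).resolve_right fun hyz =>
        h.not_adj_across hxy hxw hyz hwy h1.ne' h3

/-- The complementary case: `w` lies on the side of `y`, so the side of `x` consists of the common
neighbours that are not close to `w`. -/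
theorem adj_iff_not_side (h : G.IsRoot H) {x y w : V} (hxy : H.Adj x y) (hyw : H.Adj y w)
    (hwx : w ≠ x) (z : V) :
    H.Adj x z ↔ z = y ∨ G.Adj x z ∧ G.Adj y z ∧ ¬ (z = w ∨ G.Adj w z) := by
  constructor
  · intro hxz
    by_cases hzy : z = y
    · exact .inl hzy
    refine .inr ⟨h.le hxz, h.adj_of_common hxy.symm hxz (Ne.symm hzy), fun hw => ?_⟩
    refine h.not_adj_across hxy hxz hyw hzy hwx ?_
    exact hw.imp Eq.symm fun hw => hw.symm
  · rintro (rfl | ⟨h1, h2, h3⟩)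
    · exact hxy
    · refine (h.adj_or_adj hxy h1 h2).resolve_right fun hyz => h3 ?_
      by_cases hzw : z = w
      · exact .inl hzw
      · exact .inr (h.adj_of_common hyw.symm hyz (Ne.symm hzw))

theorem reachable_iff (h : G.IsRoot H) {a b : V} : G.Reachable a b ↔ H.Reachable a b := by
  constructor
  · rintro ⟨w⟩
    induction w with
    | nil => exact .refl _
    | cons hab _ ih =>
      refine Reachable.trans ?_ ih
      obtain ⟨-, hab | ⟨c, h1, h2⟩⟩ := (h.adj _ _).1 hab
      · exact hab.reachable
      · exact h1.reachable.trans h2.reachable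
  · exact Reachable.mono fun _ _ => h.le

end IsRoot

/-! ### Verifying a candidate root component by component -/

/-- The matrix `M` is, on the union of components `S`, a square root of `G` of girth at least six. -/
def IsRootOn [Fintype V] [DecidableEq V] (G : SimpleGraph V) [DecidableRel G.Adj] (S : V → Prop)
    (M : V → V → Bool) : Prop :=
  ∀ a, S a → M a a = false ∧ ∀ b, M a b = M b a ∧
    -- Counting the paths of length at most two says at once that the square is `G` and, as the
    -- count never exceeds 1, that there are no cycles of length three and four. The last clause
    -- excludes five-cycles while ranging over triples only.
    (a ≠ b → (M a b).toNat + ∑ c, (M a c).toNat * (M c b).toNat = (decide (G.Adj a b)).toNat) ∧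
    ∀ c, M a b = true → G.Adj a c → G.Adj b c → M a c = true ∨ M b c = true

theorem sum_toNat_mul [Fintype V] (M : V → V → Bool) (a b : V) :
    ∑ c, (M a c).toNat * (M c b).toNat =
      (Finset.univ.filter fun c => M a c = true ∧ M c b = true).card := by
  rw [Finset.card_filter]
  refine Finset.sum_congr rfl fun c _ => ?_
  cases M a c <;> cases M c b <;> rfl

section

variable [Fintype V] [DecidableEq V] {G : SimpleGraph V} [DecidableRel G.Adj]

/-- Outside the component `M` may miss edges of `H`, as it does when only one component has been
filled; it must not contain others. The girth makes a path of length at most two between two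
vertices unique. -/
theorem IsRoot.isRootOn {H : SimpleGraph V} (h : G.IsRoot H) (x : V) (M : V → V → Bool)
    (hM : ∀ a, G.Reachable x a → ∀ b, M a b = true ↔ H.Adj a b)
    (hle : ∀ a b, M a b = true → H.Adj a b) : G.IsRootOn (G.Reachable x) M := by
  intro a ha
  refine ⟨by rw [Bool.eq_false_iff, Ne, hM a ha]; exact H.loopless.irrefl a, fun b => ⟨?_, ?_, ?_⟩⟩
  · rw [Bool.eq_iff_iff, hM a ha]
    refine ⟨fun hab => ?_, fun hba => (hle b a hba).symm⟩
    exact (hM b (ha.trans (h.le hab).reachable) a).2 hab.symm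
  · intro hab
    rw [sum_toNat_mul]
    by_cases hH : H.Adj a b
    · have h1 : M a b = true := (hM a ha b).2 hH
      have h2 : (Finset.univ.filter fun c => M a c = true ∧ M c b = true) = ∅ := by
        rw [Finset.filter_eq_empty_iff]
        rintro c - ⟨h3, h4⟩
        exact h.free.three (hle _ _ h3) (hle _ _ h4) hH.symm
      simp [h1, h2, h.le hH]
    · have h1 : M a b = false := by rw [Bool.eq_false_iff, Ne, hM a ha]; exact hH
      by_cases hG : G.Adj a b
      · obtain ⟨-, h2 | ⟨c, h2, h3⟩⟩ := (h.adj a b).1 hG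
        · exact absurd h2 hH
        have h4 : (Finset.univ.filter fun c => M a c = true ∧ M c b = true) = {c} := by
          ext d
          simp only [Finset.mem_filter, Finset.mem_univ, true_and, Finset.mem_singleton]
          constructor
          · rintro ⟨h5, h6⟩
            by_contra hdc
            exact h.free.four hab hdc (hle _ _ h5) (hle _ _ h6) h3.symm h2.symm
          · rintro rfl
            exact ⟨(hM a ha _).2 h2, (hM _ (ha.trans (h.le h2).reachable) _).2 h3⟩
        simp [h1, h4, hG]
      · have h4 : (Finset.univ.filter fun c => M a c = true ∧ M c b = true) = ∅ := by
          rw [Finset.filter_eq_empty_iff]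
          rintro c - ⟨h5, h6⟩
          exact hG (h.adj_of_common (hle _ _ h5) (hle _ _ h6) hab)
        simp [h1, h4, hG]
  · intro c hab hac hbc
    have hH := hle _ _ hab
    rw [hM a ha, hM b (ha.trans (h.le hH).reachable)]
    exact h.adj_or_adj hH hac hbc

theorem IsRootOn.adj {S : V → Prop} {M : V → V → Bool} (h : G.IsRootOn S M) {a b : V} (ha : S a)
    (hab : M a b = true) : G.Adj a b := by
  have hne : a ≠ b := by
    rintro rfl
    rw [(h a ha).1] at hab
    exact Bool.false_ne_true hab
  have h1 := ((h a ha).2 b).2.1 hne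
  by_contra hG
  simp [hab, hG] at h1

theorem IsRootOn.adj_iff {S : V → Prop} {M : V → V → Bool} (h : G.IsRootOn S M) {a b : V} (ha : S a)
    (hab : a ≠ b) : G.Adj a b ↔ M a b = true ∨ ∃ c, M a c = true ∧ M c b = true := by
  have h1 := ((h a ha).2 b).2.1 hab
  rw [sum_toNat_mul] at h1
  constructor
  · intro hG
    by_contra! hno
    have h2 : (Finset.univ.filter fun c => M a c = true ∧ M c b = true) = ∅ := by
      rw [Finset.filter_eq_empty_iff]
      rintro c - ⟨h5, h6⟩
      exact hno.2 c h5 h6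
    simp [hG, h2, hno.1] at h1
  · rintro (h2 | ⟨c, h2, h3⟩)
    · exact h.adj ha h2
    · by_contra hG
      have h4 : c ∈ Finset.univ.filter fun c => M a c = true ∧ M c b = true := by simp [h2, h3]
      have := Finset.card_pos.2 ⟨c, h4⟩
      simp only [hG, decide_false, Bool.toNat_false] at h1
      omega

/-- Row `a` of the root is taken from the matrix chosen for the component of `a`. Entries of a
verified matrix are edges of `G`, so they never leave the component and the choices do not
interfere. -/
theorem exists_isRoot (h : ∀ x, ∃ M, G.IsRootOn (G.Reachable x) M) : ∃ H, G.IsRoot H := by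
  have h' : ∀ C : G.ConnectedComponent, ∃ M, G.IsRootOn (fun a => G.connectedComponentMk a = C) M := by
    intro C
    obtain ⟨x, rfl⟩ := C.exists_rep
    obtain ⟨M, hM⟩ := h x
    refine ⟨M, fun a ha => hM a ?_⟩
    exact (ConnectedComponent.exact ha).symm
  choose M hM using h'
  let N : V → V → Bool := fun a => M (G.connectedComponentMk a) a
  have hN : ∀ {a b}, N a b = true → G.connectedComponentMk a = G.connectedComponentMk b :=
    fun {a b} hab => ConnectedComponent.sound ((hM _).adj rfl hab).reachable
  have hsymm : ∀ {a b}, N a b = true → N b a = true := by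
    intro a b hab
    have := ((hM (G.connectedComponentMk a) a rfl).2 b).1
    simp only [N, ← hN hab]
    rw [← this]
    exact hab
  have hadj : ∀ {a b}, N a b = true → G.Adj a b := fun {a b} hab => (hM _).adj rfl hab
  have hirr : ∀ a, N a a ≠ true := fun a => by simp only [N, (hM _ a rfl).1]; simp
  have hmul : ∀ {a b c}, N a c = true → N c b = true → M (G.connectedComponentMk a) c b = true := by
    intro a b c hac hcb
    rw [hN hac]
    exact hcb
  have hle : ∀ {a b}, a ≠ b → (N a b).toNat + (Finset.univ.filter fun c => M
      (G.connectedComponentMk a) a c = true ∧ M (G.connectedComponentMk a) c b = true).card ≤ 1 := by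
    intro a b hab
    have := ((hM (G.connectedComponentMk a) a rfl).2 b).2.1 hab
    rw [sum_toNat_mul] at this
    exact this.trans_le (Bool.toNat_le _)
  have hthree : ∀ {a b c}, N a b = true → N b c = true → N c a = true → False := by
    intro a b c hab hbc hca
    have hne : a ≠ c := fun hac => hirr a (hac ▸ hca)
    have h1 := hle hne
    have h2 : b ∈ Finset.univ.filter fun d => M (G.connectedComponentMk a) a d = true ∧
        M (G.connectedComponentMk a) d c = true := by
      simpa using ⟨hab, hmul hab hbc⟩
    have h3 := Finset.card_pos.2 ⟨b, h2⟩
    rw [hsymm hca] at h1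
    simp only [Bool.toNat_true] at h1
    omega
  have htwo : ∀ {a b c}, a ≠ c → N a b = true → N b c = true → G.Adj a c := by
    intro a b c hac hab hbc
    exact ((hM _).adj_iff rfl hac).2 (.inr ⟨b, hab, hmul hab hbc⟩)
  refine ⟨⟨fun a b => N a b = true, ⟨fun _ _ => hsymm⟩, ⟨hirr⟩⟩, ⟨hthree, ?_, ?_⟩, ?_⟩
  · intro a b c d hac hbd hab hbc hcd hda
    have h1 := hle hac
    have h2 : ({b, d} : Finset V) ⊆ Finset.univ.filter fun e =>
        M (G.connectedComponentMk a) a e = true ∧ M (G.connectedComponentMk a) e c = true := by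
      intro e he
      simp only [Finset.mem_insert, Finset.mem_singleton] at he
      rcases he with rfl | rfl
      · simpa using ⟨hab, hmul hab hbc⟩
      · simpa using ⟨hsymm hda, hmul (hsymm hda) (hsymm hcd)⟩
    have h3 := Finset.card_le_card h2
    rw [Finset.card_pair hbd] at h3
    omega
  · intro a b c d e hab hbc hcd hde hea
    -- In a five-cycle `d` is at distance two from both ends of the edge `a b`, so the last clause
    -- of `IsRootOn` yields a chord `a d` or `b d`, hence a triangle.
    have had : a ≠ d := by rintro rfl; exact hthree hab hbc hcd
    have hbd : b ≠ d := by rintro rfl; exact hthree hde hea hab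
    have h1 : G.Adj a d := htwo had (hsymm hea) (hsymm hde)
    have h2 : G.Adj b d := htwo hbd hbc hcd
    rcases ((hM _ a rfl).2 b).2.2 d hab h1 h2 with h3 | h3
    · exact hthree (a := a) h3 hde hea
    · rw [hN hab] at h3
      exact hthree (a := b) h3 (hsymm hcd) (hsymm hbc)
  · intro a b
    constructor
    · intro hG
      refine ⟨hG.ne, ((hM _).adj_iff rfl hG.ne).1 hG |>.imp_right ?_⟩
      rintro ⟨c, h1, h2⟩
      refine ⟨c, h1, ?_⟩
      change M (G.connectedComponentMk c) c b = true
      rw [← hN h1]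
      exact h2
    · rintro ⟨hab, h1 | ⟨c, h1, h2⟩⟩
      · exact hadj h1
      · exact htwo hab h1 h2

end

end SimpleGraph


/-! ### Polynomial cost bounds and frame rules for matrix programs -/

namespace RAM

/-- What round `i` achieves has to survive all other rounds; `I` collects what may be assumed
throughout. -/
theorem forFin_all {n : ℕ} {α : Type} (f : Fin n → α → α) (I : α → Prop) (P : Fin n → α → Prop)
    (hI : ∀ i a, I a → I (f i a)) (hP : ∀ i a, I a → P i (f i a))
    (hpres : ∀ i j a, I a → P j a → P j (f i a)) (a : α) (ha : I a) :
    I (forFin f n le_rfl a) ∧ ∀ i, P i (forFin f n le_rfl a) := by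
  have key := forFin_invariant f (fun k a => I a ∧ ∀ i : Fin n, k ≤ i → P i a) ?_ n le_rfl a
    ⟨ha, fun i hi => absurd i.isLt (by omega)⟩
  · exact ⟨key.1, fun i => key.2 i (Nat.zero_le _)⟩
  · rintro i b ⟨h1, h2⟩
    refine ⟨hI i b h1, fun j hj => ?_⟩
    rcases hj.eq_or_lt with hj | hj
    · rw [← Fin.ext hj]
      exact hP i b h1
    · exact hpres i j b h1 (h2 j hj)

/-- The cost of `e` is at most `e.coeff * n ^ e.deg`. -/
def Expr.deg : Expr → ℕ
  | num _ => 0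
  | cell _ _ _ => 0
  | eq _ _ => 0
  | add a b => max a.deg b.deg
  | sub a b => max a.deg b.deg
  | mul a b => max a.deg b.deg
  | sum _ e => e.deg + 1

def Expr.coeff : Expr → ℕ
  | num _ => 1
  | cell _ _ _ => 6
  | eq _ _ => 5
  | add a b => a.coeff + b.coeff + 1
  | sub a b => a.coeff + b.coeff + 1
  | mul a b => a.coeff + b.coeff + 1
  | sum _ e => e.coeff + 10

theorem pow_bound {n a c d D : ℕ} (hn : 1 ≤ n) (h : a ≤ c * n ^ d) (hd : d ≤ D) : a ≤ c * n ^ D :=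
  h.trans (Nat.mul_le_mul_left _ (Nat.pow_le_pow_right hn hd))

theorem Expr.cost_le {n : ℕ} (hn : 1 ≤ n) (e : Expr) : e.cost n ≤ e.coeff * n ^ e.deg := by
  have binary : ∀ {a b c c' d d' : ℕ}, a ≤ c * n ^ d → b ≤ c' * n ^ d' →
      a + (b + 1) ≤ (c + c' + 1) * n ^ max d d' := by
    intro a b c c' d d' h h'
    have h1 := pow_bound hn h (le_max_left d d')
    have h2 := pow_bound hn h' (le_max_right d d')
    have h3 : 1 ≤ n ^ max d d' := Nat.one_le_pow _ _ hn
    linarith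
  induction e with
  | num k => simp [cost, coeff, deg]
  | cell k x y => simp [cost, coeff, deg]
  | eq x y => simp [cost, coeff, deg]
  | add a b iha ihb => exact binary iha ihb
  | sub a b iha ihb => exact binary iha ihb
  | mul a b iha ihb => exact binary iha ihb
  | sum x e ih =>
    simp only [cost, coeff, deg, pow_succ]
    have h3 : 1 ≤ n ^ e.deg := Nat.one_le_pow _ _ hn
    have h4 : n * e.cost n ≤ n * (e.coeff * n ^ e.deg) := Nat.mul_le_mul_left _ ih
    nlinarith [Nat.mul_le_mul hn h3]

namespace Prog

/-- The cost of `p` is at most `p.coeff * n ^ p.deg`. -/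
def deg : Prog → ℕ
  | write _ _ _ e => e.deg
  | seq p q => max p.deg q.deg
  | when e p => max e.deg p.deg
  | each _ p => p.deg + 1
  -- The search evaluates `e` for all values of the variable, but the body is executed at most once.
  | pick _ e p => max (e.deg + 1) p.deg

def coeff : Prog → ℕ
  | write _ _ _ e => e.coeff + 9
  | seq p q => p.coeff + q.coeff
  | when e p => e.coeff + 2 + p.coeff
  | each _ p => p.coeff + 8
  | pick _ e p => e.coeff + 19 + p.coeff

theorem cost_le {n : ℕ} (hn : 1 ≤ n) (p : Prog) (ρ : ℕ → Fin n) (A : Arrays n) :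
    p.cost ρ A ≤ p.coeff * n ^ p.deg := by
  induction p generalizing ρ A with
  | write k x y e =>
    have h1 := e.cost_le hn
    have h3 : 1 ≤ n ^ e.deg := Nat.one_le_pow _ _ hn
    simp only [cost, coeff, deg]
    linarith
  | seq p q ihp ihq =>
    simp only [cost, coeff, deg, add_mul]
    exact Nat.add_le_add (pow_bound hn (ihp ρ A) (le_max_left _ _))
      (pow_bound hn (ihq ρ _) (le_max_right _ _))
  | when e p ih =>
    have h1 := pow_bound hn (e.cost_le hn) (le_max_left e.deg p.deg)
    have h2 := pow_bound hn (ih ρ A) (le_max_right e.deg p.deg)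
    have h3 : 1 ≤ n ^ max e.deg p.deg := Nat.one_le_pow _ _ hn
    simp only [cost, coeff, deg]
    split_ifs <;> linarith [Nat.zero_le (p.coeff * n ^ max e.deg p.deg)]
  | each x p ih =>
    have h1 := forCost_le_const (fun i A => p.eval (Function.update ρ x i) A)
      (fun i A => 3 + p.cost (Function.update ρ x i) A) (3 + p.coeff * n ^ p.deg)
      (fun i A => Nat.add_le_add_left (ih _ _) _) A
    have h3 : 1 ≤ n ^ p.deg := Nat.one_le_pow _ _ hn
    simp only [cost, coeff, deg, pow_succ]
    nlinarith [Nat.mul_le_mul hn h3]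
  | pick x e p ih =>
    simp only [cost, coeff, deg]
    have h1 : n * (e.cost n + 7) ≤ (e.coeff + 7) * n ^ (e.deg + 1) := by
      rw [pow_succ]
      have := Nat.mul_le_mul_left n (e.cost_le hn)
      have h3 : 1 ≤ n ^ e.deg := Nat.one_le_pow _ _ hn
      nlinarith [Nat.mul_le_mul_left n h3]
    replace h1 := pow_bound hn h1 (le_max_left (e.deg + 1) p.deg)
    have h3 : 1 ≤ n ^ max (e.deg + 1) p.deg := Nat.one_le_pow _ _ hn
    have h2 : ((find fun i => e.eval A (Function.update ρ x i)).elim 0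
        fun i => p.cost (Function.update ρ x i) A) ≤ p.coeff * n ^ max (e.deg + 1) p.deg := by
      cases find fun i => e.eval A (Function.update ρ x i) with
      | none => exact Nat.zero_le _
      | some i => exact pow_bound hn (ih _ _) (le_max_right _ _)
    linarith

/-- The numbers of the arrays that `p` writes to. -/
def writes : Prog → List ℕ
  | write k _ _ _ => [k]
  | seq p q => p.writes ++ q.writes
  | when _ p => p.writes
  | each _ p => p.writes
  | pick _ _ p => p.writes

theorem eval_of_notMem_writes {n k : ℕ} (p : Prog) (hk : k ∉ p.writes) (ρ : ℕ → Fin n)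
    (A : Arrays n) : p.eval ρ A k = A k := by
  induction p generalizing ρ A with
  | write k' x y e =>
    funext i j
    simp only [writes, List.mem_singleton] at hk
    simp [eval, hk]
  | seq p q ihp ihq =>
    simp only [writes, List.mem_append, not_or] at hk
    rw [eval, ihq hk.2, ihp hk.1]
  | when e p ih =>
    rw [eval]
    split_ifs
    · exact ih hk _ _
    · rfl
  | each x p ih =>
    exact forFin_invariant (fun i A => p.eval (Function.update ρ x i) A) (fun _ A' => A' k = A k)
      (fun i A' h => (ih hk _ _).trans h) n le_rfl A rfl
  | pick x e p ih =>
    rw [eval]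
    cases find fun i => e.eval A (Function.update ρ x i) with
    | none => rfl
    | some i => exact ih hk _ _

theorem eval_pick_none {n x : ℕ} {e : Expr} {p : Prog} {ρ : ℕ → Fin n} {A : Arrays n}
    (h : (find fun i => e.eval A (Function.update ρ x i)) = none) : (pick x e p).eval ρ A = A := by
  rw [eval, h]
  rfl

theorem eval_pick_some {n x : ℕ} {e : Expr} {p : Prog} {ρ : ℕ → Fin n} {A : Arrays n} {i : Fin n}
    (h : (find fun i => e.eval A (Function.update ρ x i)) = some i) :
    (pick x e p).eval ρ A = p.eval (Function.update ρ x i) A := by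
  rw [eval, h]
  rfl

/-- Writing a row whose new entries do not depend on the old ones. -/
theorem eval_row {n k x z : ℕ} {e : Expr} {ρ : ℕ → Fin n} {A : Arrays n} (hz : x ≠ z)
    (he : ∀ (A' : Arrays n) i, (∀ k' i', ¬ (k' = k ∧ i' = ρ x) → A' k' i' = A k' i') →
      e.eval A' (Function.update ρ z i) = e.eval A (Function.update ρ z i)) (k' : ℕ) (i j : Fin n) :
    (each z (write k x z e)).eval ρ A k' i j =
      if k' = k ∧ i = ρ x then decide (e.eval A (Function.update ρ z j) ≠ 0) else A k' i j := by
  have key := forFin_all (fun l A => (write k x z e).eval (Function.update ρ z l) A)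
    (fun A' => ∀ k' i', ¬ (k' = k ∧ i' = ρ x) → A' k' i' = A k' i')
    (fun j A' => A' k (ρ x) j = decide (e.eval A (Function.update ρ z j) ≠ 0)) ?_ ?_ ?_ A
    (fun _ _ _ => rfl)
  · rw [eval]
    split_ifs with h
    · rw [h.1, h.2]
      exact key.2 j
    · rw [key.1 k' i h]
  · intro l A' h k' i' hk
    funext j
    simp only [eval, Function.update_of_ne hz]
    rw [if_neg (by tauto), h k' i' hk]
  · intro l A' h
    simp [eval, Function.update_of_ne hz, he A' l h]
  · intro l j A' h hj
    simp only [eval, Function.update_of_ne hz, Function.update_self, true_and, he A' l h]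
    split_ifs with hjl
    · rw [hjl]
    · exact hj

end Prog

/-! ### The algorithm -/

open RAM.Expr RAM.Prog

/-- The degree of the vertex in variable `x`. -/
def degreeExpr (x : ℕ) : Expr := sum 4 (cell 0 x 4)

/-- Nonzero if variable `0` is not isolated and has the least degree in its component. -/
def localMinExpr : Expr :=
  mul (degreeExpr 0) (sub (num 1) (sum 2 (mul (cell 1 0 2) (sub (degreeExpr 0) (degreeExpr 2)))))

def neExpr (a b : Expr) : Expr := add (sub a b) (sub b a)

/-- Nonzero if array `2` is a square root of array `0` of girth at least six on the row of
variable `0` in array `1`. -/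
def rootExpr : Expr :=
  sub (num 1) (sum 2 (mul (cell 1 0 2) (add (cell 2 2 2) (sum 3 (add
    (neExpr (cell 2 2 3) (cell 2 3 2))
    (add
      (mul (sub (num 1) (eq 2 3))
        (neExpr (add (cell 2 2 3) (sum 4 (mul (cell 2 2 4) (cell 2 4 3)))) (cell 0 2 3)))
      (sum 4 (mul (mul (cell 2 2 3) (mul (cell 0 2 4) (cell 0 3 4)))
        (sub (num 1) (add (cell 2 2 4) (cell 2 3 4)))))))))))

/-- One round of the computation of reachability in array `1`. -/
def reachRound : Prog :=
  each 2 (each 3 (write 1 2 3 (add (cell 1 2 3) (sum 4 (mul (cell 1 2 4) (cell 0 4 3))))))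

/-- Variable `8` only counts: `n` rounds suffice because paths have fewer than `n` edges. -/
def reachProg : Prog := seq (each 2 (write 1 2 2 (num 1))) (each 8 reachRound)

def clearProg : Prog := each 2 (each 3 (write 2 2 3 (num 0)))

/-- On which side of the common neighbourhood variable `9` lies. -/
def sideExpr : Bool → Expr
  | true => add (eq 9 5) (cell 0 5 9)
  | false => sub (num 1) (add (eq 9 5) (cell 0 5 9))

/-- Guess the neighbourhood of variable `0`, given that variable `1` belongs to it. -/
def guessProg (f : Bool) : Prog :=
  -- The default, kept if `pick` finds no common neighbour: then variable `1` is the only possible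
  -- `H`-neighbour.
  seq (each 9 (write 2 0 9 (eq 9 1))) <|
    pick 5 (mul (cell 0 0 5) (cell 0 1 5)) <|
      each 9 (write 2 0 9 (add (eq 9 1) (mul (mul (cell 0 0 9) (cell 0 1 9)) (sideExpr f))))

/-- Compute the neighbourhood of variable `7` from that of a neighbour. -/
def spreadStep : Prog :=
  pick 6 (cell 2 6 7) <| each 9 <| write 2 7 9 <|
    add (eq 9 6) (mul (mul (cell 0 7 9) (cell 0 6 9)) (sub (num 1) (cell 2 6 9)))

/-- Each of the `n` passes reaches at least one step further in `H`. A single `spreadStep` is linear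
in `n`, as searching for a neighbour and writing a row are separate loops. -/
def spreadProg : Prog := each 8 (each 7 spreadStep)

def testProg (f : Bool) : Prog :=
  seq clearProg <| seq (guessProg f) <| seq spreadProg <| when rootExpr (write 3 0 0 (num 1))

/-- The `H`-neighbours of the start vertex are unknown, but they are among its `G`-neighbours, so
all of these are tried with both bits. -/
def testsProg : Prog := each 1 (when (cell 0 0 1) (seq (testProg true) (testProg false)))

/-- Array `0` is `G`, `1` reachability, `2` the candidate root, and the diagonal of `3` marks start
vertices whose component has a verified root. Variable `0` is the start vertex, `1` its presumed
`H`-neighbour, `5` the vertex whose side is guessed, `6` and `7` the two ends of a spreading step.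
-/
def mainProg : Prog := seq reachProg (each 0 (when localMinExpr testsProg))

def answerExpr : Expr := sub (num 1) (sum 0 (mul localMinExpr (sub (num 1) (cell 3 0 0))))

/-! ### Correctness of the algorithm -/

section Correctness

variable {n : ℕ} (G : SimpleGraph (Fin n)) [DecidableRel G.Adj]

/-- Array `0` is the adjacency matrix of `G`. -/
def HasGraph (A : Arrays n) : Prop := ∀ i j, A 0 i j = decide (G.Adj i j)

variable {G}

theorem HasGraph.of_eq {A A' : Arrays n} (h : HasGraph G A) (h0 : A' 0 = A 0) : HasGraph G A' :=
  fun i j => by rw [h0, h]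

theorem degreeExpr_eval {A : Arrays n} (h : HasGraph G A) (x : ℕ) (hx : x ≠ 4) (ρ : ℕ → Fin n) :
    (degreeExpr x).eval A ρ = G.degree (ρ x) := by
  rw [SimpleGraph.degree, SimpleGraph.neighborFinset_eq_filter, Finset.card_filter]
  refine Finset.sum_congr rfl fun i _ => ?_
  simp only [Expr.eval, Function.update_of_ne hx, Function.update_self, h (ρ x) i]
  by_cases hi : G.Adj (ρ x) i <;> simp [hi]

theorem localMinExpr_eval {A : Arrays n} (h : HasGraph G A) (ρ : ℕ → Fin n) :
    localMinExpr.eval A ρ ≠ 0 ↔ G.degree (ρ 0) ≠ 0 ∧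
      ∀ u, A 1 (ρ 0) u = true → G.degree (ρ 0) ≤ G.degree u := by
  simp only [localMinExpr, Expr.eval, degreeExpr_eval h _ (show (0 : ℕ) ≠ 4 by decide),
    degreeExpr_eval h _ (show (2 : ℕ) ≠ 4 by decide), mul_ne_zero_iff, Nat.sub_ne_zero_iff_lt,
    Nat.lt_one_iff, Finset.sum_eq_zero_iff, Finset.mem_univ, true_imp_iff, mul_eq_zero]
  refine and_congr_right fun _ => forall_congr' fun u => ?_
  rw [Function.update_self, Function.update_of_ne (by decide)]
  simp [Nat.sub_eq_zero_iff_le, imp_iff_not_or]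

theorem rootExpr_eval {A : Arrays n} (h : HasGraph G A) (ρ : ℕ → Fin n) :
    rootExpr.eval A ρ ≠ 0 ↔ G.IsRootOn (fun a => A 1 (ρ 0) a = true) (A 2) := by
  simp only [rootExpr, neExpr, Expr.eval, Nat.sub_ne_zero_iff_lt, Nat.lt_one_iff,
    Finset.sum_eq_zero_iff, Finset.mem_univ, true_imp_iff, mul_eq_zero, add_eq_zero]
  refine forall_congr' fun a => ?_
  simp only [Function.update_apply]
  simp only [show ∀ i j, A 0 i j = decide (G.Adj i j) from h, Nat.reduceEqDiff,
    OfNat.zero_ne_ofNat, if_true, if_false]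
  have hne : ∀ x y : ℕ, (x - y = 0 ∧ y - x = 0) ↔ x = y := fun x y => by omega
  have hinj : ∀ x y : Bool, x.toNat = y.toNat ↔ x = y := by decide
  by_cases ha : A 1 (ρ 0) a = true
  · simp only [ha, true_imp_iff]
    simp only [hne, hinj, Bool.toNat_true, one_ne_zero, false_or, Bool.toNat_eq_zero,
      decide_eq_false_iff_not]
    refine and_congr_right fun _ => forall_congr' fun b => and_congr_right fun _ => ?_
    refine and_congr ?_ (forall_congr' fun c => ?_)
    · by_cases hab : a = b <;> simp [hab]
    · cases A 2 a b <;> cases A 2 a c <;> cases A 2 b c <;> simp [imp_iff_not_or]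
  · simp [ha]

/-- The array is updated while it is being read, so a round may advance by more than one edge. Hence
only soundness, monotonicity and progress by at least one edge are claimed. -/
theorem reachRound_spec {A : Arrays n} (h : HasGraph G A) (ρ : ℕ → Fin n)
    (hs : ∀ a b, A 1 a b = true → G.Reachable a b) :
    (∀ a b, reachRound.eval ρ A 1 a b = true → G.Reachable a b) ∧
    (∀ a b, A 1 a b = true → reachRound.eval ρ A 1 a b = true) ∧
    ∀ a b c, A 1 a c = true → G.Adj c b → reachRound.eval ρ A 1 a b = true := by
  let f (a b : Fin n) (A : Arrays n) : Arrays n :=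
    (write 1 2 3 (add (cell 1 2 3) (sum 4 (mul (cell 1 2 4) (cell 0 4 3))))).eval
      (Function.update (Function.update ρ 2 a) 3 b) A
  have hf : ∀ a b A, HasGraph G A → ∀ i j, f a b A 1 i j = true ↔ A 1 i j = true ∨
      (i = a ∧ j = b) ∧ ∃ c, A 1 a c = true ∧ G.Adj c b := by
    intro a b A hA i j
    simp only [HasGraph] at hA
    simp only [f, Prog.eval, Expr.eval]
    by_cases hij : i = a ∧ j = b
    · simp [hij, hA, Classical.not_forall]
    · simp [hij]
  have hf0 : ∀ a b A, f a b A 0 = A 0 := fun a b A =>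
    eval_of_notMem_writes _ (by simp [writes]) _ _
  let I (A' : Arrays n) : Prop := HasGraph G A' ∧ (∀ a b, A' 1 a b = true → G.Reachable a b) ∧
    ∀ a b, A 1 a b = true → A' 1 a b = true
  have hI : ∀ a b A', I A' → I (f a b A') := by
    rintro a b A' ⟨h1, h2, h3⟩
    refine ⟨h1.of_eq (hf0 _ _ _), fun i j hij => ?_, fun i j hij =>
      (hf a b A' h1 i j).2 (.inl (h3 i j hij))⟩
    rcases (hf a b A' h1 i j).1 hij with hij | ⟨⟨rfl, rfl⟩, c, hc, hcb⟩
    · exact h2 i j hij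
    · exact (h2 _ _ hc).trans hcb.reachable
  have inner : ∀ a A', I A' → (I (forFin (f a) n le_rfl A') ∧
      ∀ i j, A' 1 i j = true → forFin (f a) n le_rfl A' 1 i j = true) ∧
      ∀ b c, A 1 a c = true → G.Adj c b → forFin (f a) n le_rfl A' 1 a b = true := by
    intro a A' hA'
    refine forFin_all (f a) (fun B => I B ∧ ∀ i j, A' 1 i j = true → B 1 i j = true)
      (fun b B => ∀ c, A 1 a c = true → G.Adj c b → B 1 a b = true) ?_ ?_ ?_ A' ⟨hA', fun _ _ h => h⟩
    · rintro b B ⟨h1, h2⟩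
      exact ⟨hI a b B h1, fun i j hij => (hf a b B h1.1 i j).2 (.inl (h2 i j hij))⟩
    · rintro b B ⟨h1, -⟩ c hc hcb
      exact (hf a b B h1.1 a b).2 (.inr ⟨⟨rfl, rfl⟩, c, h1.2.2 a c hc, hcb⟩)
    · rintro b b' B ⟨h1, -⟩ h3 c hc hcb
      exact (hf a b B h1.1 a b').2 (.inl (h3 c hc hcb))
  have outer := forFin_all (fun a => forFin (f a) n le_rfl) I
    (fun a B => ∀ b c, A 1 a c = true → G.Adj c b → B 1 a b = true)
    (fun a B hB => (inner a B hB).1.1) (fun a B hB => (inner a B hB).2)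
    (fun a a' B hB hP b c hc hcb => (inner a B hB).1.2 _ _ (hP b c hc hcb)) A
    ⟨h, hs, fun _ _ h => h⟩
  exact ⟨outer.1.2.1, outer.1.2.2, outer.2⟩

theorem reachProg_spec {A : Arrays n} (h : HasGraph G A) (ρ : ℕ → Fin n) (h1 : ∀ i j, A 1 i j = false)
    (a b : Fin n) : reachProg.eval ρ A 1 a b = true ↔ G.Reachable a b := by
  let A' := (each 2 (write 1 2 2 (num 1))).eval ρ A
  have hA' : HasGraph G A' := h.of_eq (eval_of_notMem_writes _ (by simp [writes]) _ _)
  have hdiag : (∀ i j, A' 1 i j = true → i = j) ∧ ∀ i, A' 1 i i = true := by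
    refine forFin_all _ (fun B : Arrays n => ∀ i j, B 1 i j = true → i = j)
      (fun i B => B 1 i i = true) ?_ ?_ ?_ A (by simp [h1])
    · intro l B hB i j
      simp only [Prog.eval, Function.update_self]
      split_ifs with hij
      · rw [hij.2.1, hij.2.2]; simp
      · exact hB i j
    · intro l B hB
      simp [Prog.eval, Expr.eval]
    · intro l i B hB hi
      simp [Prog.eval, Expr.eval, hi]
  -- With `k` rounds left, walks of length at most `n - k` have been found. They run from `b` back
  -- to `a`, so that removing their first edge undoes the latest extension.
  have key := forFin_invariant (fun i A => reachRound.eval (Function.update ρ 8 i) A)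
    (fun k B => HasGraph G B ∧ (∀ a b, B 1 a b = true → G.Reachable a b) ∧
      ∀ a b, (∃ w : G.Walk b a, w.length + k ≤ n) → B 1 a b = true) ?_ n le_rfl A'
    ⟨hA', fun i j hij => hdiag.1 i j hij ▸ .refl _, ?_⟩
  · refine ⟨key.2.1 a b, fun hab => key.2.2 a b ?_⟩
    obtain ⟨w, hw⟩ := hab.symm.exists_isPath
    have := hw.length_lt
    rw [Fintype.card_fin] at this
    exact ⟨w, by omega⟩
  · rintro i B ⟨hB, hs, hB'⟩
    obtain ⟨r1, r2, r3⟩ := reachRound_spec hB (Function.update ρ 8 i) hs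
    refine ⟨hB.of_eq (eval_of_notMem_writes _ (by simp [reachRound, writes]) _ _), r1, ?_⟩
    rintro a b ⟨w, hw⟩
    cases w with
    | nil => exact r2 a a (hB' a a ⟨.nil, by simp⟩)
    | cons hbc w =>
      refine r3 a b _ (hB' _ _ ⟨w, ?_⟩) hbc.symm
      rw [SimpleGraph.Walk.length_cons] at hw
      omega
  · rintro i j ⟨w, hw⟩
    have hw : w.length = 0 := by omega
    rw [SimpleGraph.Walk.eq_of_length_eq_zero hw]
    exact hdiag.2 i

theorem clearProg_eval {A : Arrays n} (ρ : ℕ → Fin n) (i j : Fin n) :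
    clearProg.eval ρ A 2 i j = false := by
  have hrow : ∀ a (B : Arrays n) i j, (each 3 (write 2 2 3 (num 0))).eval
      (Function.update ρ 2 a) B 2 i j = if i = a then false else B 2 i j := by
    intro a B i j
    rw [eval_row (by decide) fun _ _ _ => rfl]
    simp [Expr.eval]
  refine (forFin_all _ (fun _ : Arrays n => True) (fun i B => ∀ j, B 2 i j = false)
    (fun _ _ _ => trivial) ?_ ?_ A trivial).2 i j
  · intro a B _ j
    rw [hrow]
    simp
  · intro a i B _ hB j
    rw [hrow]
    simp [hB]

/-- The bit is chosen before the arrays because the vertex picked depends on `G` only; the two tests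
start from different arrays but face the same `w`. If there is no common neighbour, `N_H(x) = {y}`,
since a further `H`-neighbour of `x` would be one. -/
theorem guessProg_spec (ρ : ℕ → Fin n) {H : SimpleGraph (Fin n)} (hH : G.IsRoot H)
    (hadj : H.Adj (ρ 0) (ρ 1)) :
    ∃ f, ∀ A, HasGraph G A → (∀ i j, A 2 i j = false) →
      ∀ i j, (guessProg f).eval ρ A 2 i j = true ↔ i = ρ 0 ∧ H.Adj i j := by
  let next (A : Arrays n) : Arrays n := (each 9 (write 2 0 9 (eq 9 1))).eval ρ A
  have hnext : ∀ {A}, HasGraph G A → HasGraph G (next A) := fun h =>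
    h.of_eq (eval_of_notMem_writes _ (by simp [writes]) _ _)
  have hnext2 : ∀ {A : Arrays n}, (∀ i j, A 2 i j = false) →
      ∀ i j, next A 2 i j = true ↔ i = ρ 0 ∧ j = ρ 1 := by
    intro A h2 i j
    simp only [next]
    rw [eval_row (by decide) fun _ _ _ => by simp [Expr.eval]]
    simp [Expr.eval, h2]
  let g (w : Fin n) : ℕ := (decide (G.Adj (ρ 0) w)).toNat * (decide (G.Adj (ρ 1) w)).toNat
  have hg : ∀ {A}, HasGraph G A →
      (fun w => (mul (cell 0 0 5) (cell 0 1 5)).eval (next A) (Function.update ρ 5 w)) = g := by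
    intro A h
    funext w
    simp [Expr.eval, hnext h _ _, g]
  have hcommon : ∀ w, g w ≠ 0 ↔ G.Adj (ρ 0) w ∧ G.Adj (ρ 1) w := by
    intro w
    simp [g]
  have hrow : ∀ {A}, HasGraph G A → (∀ i j, A 2 i j = false) → ∀ f w i j,
      (each 9 (write 2 0 9 (add (eq 9 1) (mul (mul (cell 0 0 9) (cell 0 1 9)) (sideExpr f))))).eval
        (Function.update ρ 5 w) (next A) 2 i j = true ↔ i = ρ 0 ∧
          (j = ρ 1 ∨ G.Adj (ρ 0) j ∧ G.Adj (ρ 1) j ∧ (f = true ↔ (j = w ∨ G.Adj w j))) := by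
    intro A h h2 f w i j
    rw [eval_row (by decide) fun B i hB => ?_]
    · by_cases hi : i = ρ 0
      · by_cases h0 : j = ρ 1 <;> by_cases h3 : j = w <;> by_cases h4 : G.Adj w j <;> cases f <;>
          simp [Expr.eval, sideExpr, hnext h _ _, hi, h0, h3, h4]
      · simp [hi, hnext2 h2]
    · have hB0 : B 0 = next A 0 := funext fun i' => hB 0 i' (by simp)
      cases f <;> simp [Expr.eval, sideExpr, hB0]
  rcases find_spec g with ⟨hf, hnone⟩ | ⟨w, hf, hw⟩
  · refine ⟨true, fun A h h2 i j => ?_⟩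
    have he : (guessProg true).eval ρ A = next A := eval_pick_none (by rw [← hf, ← hg h])
    rw [he, hnext2 h2]
    refine and_congr_right fun hi => ?_
    subst hi
    refine ⟨fun hj => hj ▸ hadj, fun hj => ?_⟩
    by_contra hne
    exact (hcommon j).2 ⟨hH.le hj, hH.adj_of_common hadj.symm hj (Ne.symm hne)⟩ (hnone j)
  · have he : ∀ {A}, HasGraph G A → ∀ f, (guessProg f).eval ρ A = (each 9 (write 2 0 9 (add (eq 9 1)
        (mul (mul (cell 0 0 9) (cell 0 1 9)) (sideExpr f))))).eval
        (Function.update ρ 5 w) (next A) :=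
      fun h f => eval_pick_some (by rw [← hf, ← hg h])
    obtain ⟨hw0, hw1⟩ := (hcommon w).1 hw
    by_cases hHw : H.Adj (ρ 0) w
    · refine ⟨true, fun A h h2 i j => ?_⟩
      rw [he h, hrow h h2]
      refine and_congr_right fun hi => ?_
      subst hi
      rw [hH.adj_iff_side hadj hHw hw1.ne']
      simp
    · refine ⟨false, fun A h h2 i j => ?_⟩
      rw [he h, hrow h h2]
      refine and_congr_right fun hi => ?_
      subst hi
      rw [hH.adj_iff_not_side hadj ((hH.adj_or_adj hadj hw0 hw1).resolve_left hHw) hw0.ne']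
      simp

/-- Every row of array `2` is zero or the neighbourhood in `H`. -/
def RowsCorrect (H : SimpleGraph (Fin n)) (A : Arrays n) : Prop :=
  ∀ a, (∀ b, A 2 a b = false) ∨ ∀ b, A 2 a b = true ↔ H.Adj a b

/-- By `RowsCorrect`, any entry `1` found in the column of the target lies in a finished row `t`, so
`t` is an `H`-neighbour of the target. The row written is then correct whichever `t` was found, and
recomputing a finished row does no damage. -/
theorem spreadStep_spec {A : Arrays n} (h : HasGraph G A) (ρ : ℕ → Fin n)
    {H : SimpleGraph (Fin n)} (hH : G.IsRoot H) (hA : RowsCorrect H A) :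
    RowsCorrect H (spreadStep.eval ρ A) ∧
    (∀ a, (∀ b, A 2 a b = true ↔ H.Adj a b) → ∀ b, spreadStep.eval ρ A 2 a b = true ↔ H.Adj a b) ∧
    ∀ t, (∀ b, A 2 t b = true ↔ H.Adj t b) → H.Adj t (ρ 7) →
      ∀ b, spreadStep.eval ρ A 2 (ρ 7) b = true ↔ H.Adj (ρ 7) b := by
  rcases find_spec fun t => (cell 2 6 7).eval A (Function.update ρ 6 t) with
    ⟨hf, hnone⟩ | ⟨t, hf, ht⟩
  · have he : spreadStep.eval ρ A = A := eval_pick_none hf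
    rw [he]
    refine ⟨hA, fun _ h => h, fun t ht htu => ?_⟩
    have := hnone t
    simp [Expr.eval, (ht _).2 htu] at this
  · have ht' : A 2 t (ρ 7) = true := by simpa [Expr.eval] using ht
    have hrow : ∀ b, A 2 t b = true ↔ H.Adj t b :=
      (hA t).resolve_left fun h0 => by simp [h0] at ht'
    have htu : H.Adj t (ρ 7) := (hrow _).1 ht'
    have he : ∀ a b, spreadStep.eval ρ A 2 a b = true ↔
        if a = ρ 7 then H.Adj a b else A 2 a b = true := by
      intro a b
      have he' : spreadStep.eval ρ A = (each 9 (write 2 7 9 (add (eq 9 6)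
          (mul (mul (cell 0 7 9) (cell 0 6 9)) (sub (num 1) (cell 2 6 9)))))).eval
          (Function.update ρ 6 t) A := eval_pick_some hf
      rw [he', eval_row (by decide) fun B i hB => ?_]
      · by_cases ha : a = ρ 7
        · subst ha
          rw [if_pos rfl, hH.adj_iff_of_adj htu, ← hrow]
          by_cases h0 : b = t <;> cases hb : A 2 t b <;> simp [Expr.eval, h _ _, h0, hb]
        · simp [ha]
      · have hB0 : B 0 = A 0 := funext fun i' => hB 0 i' (by simp)
        -- Row `t` is read while row `ρ 7` is written; they differ because `t` and `ρ 7` are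
        -- adjacent in `H`.
        have hB2 : B 2 t = A 2 t := hB 2 t (by simpa using htu.ne)
        simp [Expr.eval, hB0, hB2]
    have keep : ∀ a, (∀ b, A 2 a b = true ↔ H.Adj a b) →
        ∀ b, spreadStep.eval ρ A 2 a b = true ↔ H.Adj a b := by
      intro a ha b
      rw [he]
      split_ifs
      · rfl
      · exact ha b
    refine ⟨fun a => ?_, keep, fun _ _ _ b => by rw [he, if_pos rfl]⟩
    by_cases ha : a = ρ 7
    · exact .inr fun b => by rw [he, if_pos ha]
    · refine (hA a).imp (fun h0 b => ?_) (keep a)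
      rw [Bool.eq_false_iff, Ne, he, if_neg ha, h0]
      simp

theorem spreadProg_spec {A : Arrays n} (h : HasGraph G A) (ρ : ℕ → Fin n) {x : Fin n}
    {H : SimpleGraph (Fin n)} (hH : G.IsRoot H) (h2 : ∀ i j, A 2 i j = true ↔ i = x ∧ H.Adj i j) :
    (∀ a, G.Reachable x a → ∀ b, spreadProg.eval ρ A 2 a b = true ↔ H.Adj a b) ∧
      ∀ a b, spreadProg.eval ρ A 2 a b = true → H.Adj a b := by
  have frame : ∀ ρ B, HasGraph G B → HasGraph G (spreadStep.eval ρ B) := fun ρ B hB =>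
    hB.of_eq (eval_of_notMem_writes _ (by simp [spreadStep, writes]) _ _)
  have round : ∀ (ρ : ℕ → Fin n) B, HasGraph G B → RowsCorrect H B →
      ((HasGraph G ((each 7 spreadStep).eval ρ B) ∧ RowsCorrect H ((each 7 spreadStep).eval ρ B)) ∧
      ∀ a, (∀ b, B 2 a b = true ↔ H.Adj a b) →
        ∀ b, (each 7 spreadStep).eval ρ B 2 a b = true ↔ H.Adj a b) ∧
      ∀ u t, (∀ b, B 2 t b = true ↔ H.Adj t b) → H.Adj t u →
        ∀ b, (each 7 spreadStep).eval ρ B 2 u b = true ↔ H.Adj u b := by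
    intro ρ B hB hB'
    refine forFin_all (fun u B => spreadStep.eval (Function.update ρ 7 u) B)
      (fun B' => (HasGraph G B' ∧ RowsCorrect H B') ∧ ∀ a, (∀ b, B 2 a b = true ↔ H.Adj a b) →
        ∀ b, B' 2 a b = true ↔ H.Adj a b)
      (fun u B' => ∀ t, (∀ b, B 2 t b = true ↔ H.Adj t b) → H.Adj t u →
        ∀ b, B' 2 u b = true ↔ H.Adj u b) ?_ ?_ ?_ B ⟨⟨hB, hB'⟩, fun _ h => h⟩
    · rintro u B' ⟨⟨h1, h2⟩, h3⟩
      obtain ⟨r1, r2, -⟩ := spreadStep_spec h1 (Function.update ρ 7 u) hH h2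
      exact ⟨⟨frame _ _ h1, r1⟩, fun a ha => r2 a (h3 a ha)⟩
    · rintro u B' ⟨⟨h1, h2⟩, h3⟩ t ht htu
      have r3 := (spreadStep_spec h1 (Function.update ρ 7 u) hH h2).2.2 t (h3 t ht)
      rw [Function.update_self] at r3
      exact r3 htu
    · rintro u u' B' ⟨⟨h1, h2⟩, h3⟩ h4 t ht htu
      exact (spreadStep_spec h1 (Function.update ρ 7 u) hH h2).2.1 u' (h4 t ht htu)
  -- With `k` passes left, the rows of all vertices at `H`-distance at most `n - k` from `x` are
  -- finished.
  have key := forFin_invariant (fun i A => (each 7 spreadStep).eval (Function.update ρ 8 i) A)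
    (fun k B => (HasGraph G B ∧ RowsCorrect H B) ∧
      ∀ a, (∃ w : H.Walk a x, w.length + k ≤ n) → ∀ b, B 2 a b = true ↔ H.Adj a b) ?_ n le_rfl A
    ⟨⟨h, fun a => ?_⟩, ?_⟩
  · refine ⟨fun a ha => key.2 a ?_, fun a b hab => ?_⟩
    · obtain ⟨w, hw⟩ := (hH.reachable_iff.1 ha).symm.exists_isPath
      have := hw.length_lt
      rw [Fintype.card_fin] at this
      exact ⟨w, by omega⟩
    · rcases key.1.2 a with h0 | h0
      · exact absurd (h0 b) (by rw [Bool.eq_false_iff, not_not]; exact hab)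
      · exact (h0 b).1 hab
  · rintro i B ⟨⟨hB, hB'⟩, hx⟩
    obtain ⟨⟨r1, r2⟩, r3⟩ := round (Function.update ρ 8 i) B hB hB'
    refine ⟨r1, ?_⟩
    rintro a ⟨w, hw⟩
    cases w with
    | nil => exact r2 _ (hx _ ⟨.nil, by simp⟩)
    | cons hac w =>
      refine r3 a _ (hx _ ⟨w, ?_⟩) hac.symm
      rw [SimpleGraph.Walk.length_cons] at hw
      omega
  · by_cases ha : a = x
    · exact .inr fun b => by rw [h2]; simp [ha]
    · exact .inl fun b => by rw [Bool.eq_false_iff, Ne, h2]; simp [ha]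
  · rintro a ⟨w, hw⟩ b
    have hw : w.length = 0 := by omega
    rw [h2, SimpleGraph.Walk.eq_of_length_eq_zero hw]
    simp

/-- Arrays `0` and `1` describe adjacency and reachability, and array `3` records components that
have a square root. -/
structure Sound (G : SimpleGraph (Fin n)) [DecidableRel G.Adj] (A : Arrays n) : Prop where
  graph : HasGraph G A
  reachable : ∀ a b, A 1 a b = true ↔ G.Reachable a b
  root : ∀ i, A 3 i i = true → ∃ M, G.IsRootOn (G.Reachable i) M

/-- The entries of array `3` grow. -/
def Grows (A B : Arrays n) : Prop := ∀ i j, A 3 i j = true → B 3 i j = true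

/-- No assumption on the guess is needed: a mark is set only after the candidate passed the
verification. -/
theorem testProg_spec {A : Arrays n} (h : Sound G A) (ρ : ℕ → Fin n) (f : Bool) :
    Sound G ((testProg f).eval ρ A) ∧ Grows A ((testProg f).eval ρ A) := by
  let B := (seq clearProg (seq (guessProg f) spreadProg)).eval ρ A
  have hB : ∀ k ≠ 2, B k = A k := fun k hk => eval_of_notMem_writes _
    (by simp [writes, clearProg, guessProg, spreadProg, spreadStep, hk]) _ _
  have he : (testProg f).eval ρ A = if rootExpr.eval B ρ ≠ 0
      then (write 3 0 0 (num 1)).eval ρ B else B := rfl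
  have hBG : HasGraph G B := h.graph.of_eq (hB 0 (by decide))
  have hsound : Sound G B := by
    refine ⟨hBG, fun a b => ?_, fun i hi => h.root i ?_⟩
    · rw [hB 1 (by decide), h.reachable]
    · rwa [← hB 3 (by decide)]
  have hgrows : Grows A B := fun i j hij => by rwa [hB 3 (by decide)]
  rw [he]
  split_ifs with hr
  · refine ⟨⟨hBG, hsound.reachable, fun i hi => ?_⟩, fun i j hij => ?_⟩
    · by_cases hi0 : i = ρ 0
      · have := (rootExpr_eval hBG ρ).1 hr
        simp only [hsound.reachable] at this
        exact ⟨_, hi0 ▸ this⟩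
      · exact hsound.root i (by simpa [Prog.eval, hi0] using hi)
    · have := hgrows i j hij
      simp [Prog.eval, Expr.eval, this]
  · exact ⟨hsound, hgrows⟩

theorem testProg_complete (ρ : ℕ → Fin n) {H : SimpleGraph (Fin n)} (hH : G.IsRoot H)
    (hadj : H.Adj (ρ 0) (ρ 1)) :
    ∃ f, ∀ A, Sound G A → (testProg f).eval ρ A 3 (ρ 0) (ρ 0) = true := by
  obtain ⟨f, hf⟩ := guessProg_spec ρ hH hadj
  refine ⟨f, fun A h => ?_⟩
  have h1 : HasGraph G (clearProg.eval ρ A) :=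
    h.graph.of_eq (eval_of_notMem_writes _ (by simp [writes, clearProg]) _ _)
  have h2 := hf _ h1 (clearProg_eval ρ)
  have h3 : HasGraph G ((guessProg f).eval ρ (clearProg.eval ρ A)) :=
    h1.of_eq (eval_of_notMem_writes _ (by simp [writes, guessProg]) _ _)
  obtain ⟨h4, h5⟩ := spreadProg_spec h3 ρ hH h2
  let B := (seq clearProg (seq (guessProg f) spreadProg)).eval ρ A
  have hB : ∀ k ≠ 2, B k = A k := fun k hk => eval_of_notMem_writes _
    (by simp [writes, clearProg, guessProg, spreadProg, spreadStep, hk]) _ _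
  have he : (testProg f).eval ρ A = if rootExpr.eval B ρ ≠ 0
      then (write 3 0 0 (num 1)).eval ρ B else B := rfl
  have hr : rootExpr.eval B ρ ≠ 0 := by
    rw [rootExpr_eval (h.graph.of_eq (hB 0 (by decide)))]
    simp only [hB 1 (by decide), h.reachable]
    exact hH.isRootOn (ρ 0) _ h4 h5
  rw [he, if_pos hr]
  simp [Prog.eval, Expr.eval]

theorem Grows.refl (A : Arrays n) : Grows A A := fun _ _ h => h

theorem Grows.trans {A B C : Arrays n} (h : Grows A B) (h' : Grows B C) : Grows A C :=
  fun i j hij => h' i j (h i j hij)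

/-- A vertex that is not isolated in `G` has an `H`-neighbour `y`, namely the next vertex on a path
of length at most two. The round of `y` contains the correct guess, and marks are never removed
afterwards. -/
theorem testsProg_spec {A : Arrays n} (h : Sound G A) (ρ : ℕ → Fin n) :
    (Sound G (testsProg.eval ρ A) ∧ Grows A (testsProg.eval ρ A)) ∧
    ((∃ H, G.IsRoot H) → G.degree (ρ 0) ≠ 0 → testsProg.eval ρ A 3 (ρ 0) (ρ 0) = true) := by
  have both : ∀ (ρ : ℕ → Fin n) B, Sound G B →
      Sound G ((seq (testProg true) (testProg false)).eval ρ B) ∧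
      Grows B ((seq (testProg true) (testProg false)).eval ρ B) := by
    intro ρ B hB
    obtain ⟨h1, h2⟩ := testProg_spec hB ρ true
    obtain ⟨h3, h4⟩ := testProg_spec h1 ρ false
    exact ⟨h3, h2.trans h4⟩
  have step : ∀ (ρ : ℕ → Fin n) B, Sound G B →
      Sound G ((when (cell 0 0 1) (seq (testProg true) (testProg false))).eval ρ B) ∧
      Grows B ((when (cell 0 0 1) (seq (testProg true) (testProg false))).eval ρ B) := by
    intro ρ B hB
    rw [Prog.eval]
    split_ifs
    · exact both ρ B hB
    · exact ⟨hB, Grows.refl B⟩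
  have key := forFin_all
    (fun y B => (when (cell 0 0 1) (seq (testProg true) (testProg false))).eval
      (Function.update ρ 1 y) B)
    (fun B => Sound G B ∧ Grows A B) (fun y B => ∀ H, G.IsRoot H → H.Adj (ρ 0) y →
      B 3 (ρ 0) (ρ 0) = true) ?_ ?_ ?_ A ⟨h, Grows.refl A⟩
  · refine ⟨key.1, ?_⟩
    rintro ⟨H, hH⟩ hdeg
    rw [← Nat.pos_iff_ne_zero, SimpleGraph.degree_pos_iff_exists_adj] at hdeg
    obtain ⟨z, hz⟩ := hdeg
    obtain ⟨-, hz | ⟨y, hy, -⟩⟩ := (hH.adj _ _).1 hz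
    · exact key.2 z H hH hz
    · exact key.2 y H hH hy
  · rintro y B ⟨h1, h2⟩
    obtain ⟨h3, h4⟩ := step (Function.update ρ 1 y) B h1
    exact ⟨h3, h2.trans h4⟩
  · rintro y B ⟨h1, h2⟩ H hH hy
    have hG := h1.graph (ρ 0) y
    rw [decide_eq_true (hH.le hy)] at hG
    have he : (cell 0 0 1).eval B (Function.update ρ 1 y) ≠ 0 := by simp [Expr.eval, hG]
    rw [Prog.eval, if_pos he, Prog.eval]
    obtain ⟨f, hf⟩ := testProg_complete (Function.update ρ 1 y) hH (by simpa using hy)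
    rw [Function.update_of_ne (by decide)] at hf
    have h3 := testProg_spec h1 (Function.update ρ 1 y) true
    cases f with
    | true => exact (testProg_spec h3.1 _ false).2 _ _ (hf B h1)
    | false => exact hf _ h3.1
  · rintro y y' B ⟨h1, h2⟩ h3 H hH hy
    exact (step (Function.update ρ 1 y) B h1).2 _ _ (h3 H hH hy)

/-- The vertex `v` is not isolated and has the least degree in its component. -/
def LocalMin (G : SimpleGraph (Fin n)) [DecidableRel G.Adj] (v : Fin n) : Prop :=
  G.degree v ≠ 0 ∧ ∀ u, G.Reachable v u → G.degree v ≤ G.degree u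

theorem Sound.localMinExpr_eval {A : Arrays n} (h : Sound G A) (ρ : ℕ → Fin n) :
    localMinExpr.eval A ρ ≠ 0 ↔ LocalMin G (ρ 0) := by
  rw [RAM.localMinExpr_eval h.graph]
  simp only [h.reachable, LocalMin]

theorem reachProg_sound {A : Arrays n} (h : HasGraph G A) (h0 : ∀ k ≠ 0, ∀ i j, A k i j = false)
    (ρ : ℕ → Fin n) : Sound G (reachProg.eval ρ A) := by
  refine ⟨h.of_eq (eval_of_notMem_writes _ (by simp [reachProg, reachRound, writes]) _ _),
    reachProg_spec h ρ (h0 1 (by decide)), fun i hi => ?_⟩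
  rw [eval_of_notMem_writes _ (by simp [reachProg, reachRound, writes]), h0 3 (by decide)] at hi
  exact absurd hi (by simp)

theorem componentStep_sound {A : Arrays n} (h : Sound G A) (ρ : ℕ → Fin n) :
    Sound G ((when localMinExpr testsProg).eval ρ A) ∧
      Grows A ((when localMinExpr testsProg).eval ρ A) := by
  rw [Prog.eval]
  split_ifs
  · exact (testsProg_spec h ρ).1
  · exact ⟨h, Grows.refl A⟩

theorem mainProg_spec {A : Arrays n} (h : HasGraph G A) (h0 : ∀ k ≠ 0, ∀ i j, A k i j = false)
    (ρ : ℕ → Fin n) : Sound G (mainProg.eval ρ A) ∧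
      ((∃ H, G.IsRoot H) → ∀ v, LocalMin G v → mainProg.eval ρ A 3 v v = true) := by
  have key := forFin_all
    (fun v B => (when localMinExpr testsProg).eval (Function.update ρ 0 v) B)
    (Sound G) (fun v B => (∃ H, G.IsRoot H) → LocalMin G v → B 3 v v = true)
    (fun v B hB => (componentStep_sound hB _).1) ?_ ?_ _ (reachProg_sound h h0 ρ)
  · exact ⟨key.1, fun hH v => key.2 v hH⟩
  · intro v B hB hH hv
    rw [Prog.eval, if_pos ((hB.localMinExpr_eval _).2 (by simpa using hv))]
    have := (testsProg_spec hB (Function.update ρ 0 v)).2 hH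
    rw [Function.update_self] at this
    exact this hv.1
  · intro v v' B hB hP hH hv
    exact (componentStep_sound hB _).2 _ _ (hP hH hv)

/-- Every component has a vertex of least degree. If its degree is zero, the component is a single
vertex and the zero matrix is a root on it; otherwise its mark provides one. -/
theorem Sound.exists_isRoot {A : Arrays n} (h : Sound G A)
    (hA : ∀ v, LocalMin G v → A 3 v v = true) : ∃ H, G.IsRoot H := by
  classical
  refine SimpleGraph.exists_isRoot fun x => ?_
  obtain ⟨u, hu, hmin⟩ := Finset.exists_min_image (Finset.univ.filter fun u => G.Reachable x u)
    (fun u => G.degree u) ⟨x, by simp⟩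
  simp only [Finset.mem_filter, Finset.mem_univ, true_and] at hu hmin
  by_cases hdeg : G.degree u = 0
  · have hux : x = u := by
      obtain ⟨w⟩ := hu.symm
      cases w with
      | nil => rfl
      | cons hadj _ =>
        exact absurd hdeg (SimpleGraph.degree_pos_iff_exists_adj _ _ |>.2 ⟨_, hadj⟩).ne'
    subst hux
    have hno : ∀ b, ¬ G.Adj x b := fun b hb =>
      (SimpleGraph.degree_pos_iff_exists_adj _ _ |>.2 ⟨b, hb⟩).ne' hdeg
    refine ⟨fun _ _ => false, ?_⟩
    rintro a ⟨w⟩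
    cases w with
    | nil => simp [hno]
    | cons hadj _ => exact absurd hadj (hno _)
  · obtain ⟨M, hM⟩ := h.root u (hA u ⟨hdeg, fun v hv => hmin v (hu.trans hv)⟩)
    exact ⟨M, fun a ha => hM a (hu.symm.trans ha)⟩

theorem Sound.answerExpr_eval {A : Arrays n} (h : Sound G A) (ρ : ℕ → Fin n) :
    (answerExpr.eval A ρ = 1 ∧ ∀ v, LocalMin G v → A 3 v v = true) ∨
      (answerExpr.eval A ρ = 0 ∧ ¬ ∀ v, LocalMin G v → A 3 v v = true) := by
  have key : (∑ v, (mul localMinExpr (sub (num 1) (cell 3 0 0))).eval A (Function.update ρ 0 v)) = 0 ↔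
      ∀ v, LocalMin G v → A 3 v v = true := by
    simp only [Finset.sum_eq_zero_iff, Finset.mem_univ, true_imp_iff]
    refine forall_congr' fun v => ?_
    have hv := h.localMinExpr_eval (Function.update ρ 0 v)
    rw [Function.update_self] at hv
    rw [← hv]
    cases hA : A 3 v v <;> simp [Expr.eval, hA]
  rw [← key]
  simp only [answerExpr, Expr.eval]
  omega

/-! ### Running time -/

theorem testsProg_cost {A : Arrays n} (h : Sound G A) (ρ : ℕ → Fin n) :
    testsProg.cost ρ A ≤ 4 + n * 12 +
      G.degree (ρ 0) * ((seq (testProg true) (testProg false)).coeff * n ^ 3) := by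
  have hn := (ρ 0).pos
  set K := (seq (testProg true) (testProg false)).coeff * n ^ 3 with hK
  have hcost : ∀ (ρ : ℕ → Fin n) B, (seq (testProg true) (testProg false)).cost ρ B ≤ K :=
    fun ρ B => cost_le hn _ ρ B
  have key := forCost_le
    (fun y B => (when (cell 0 0 1) (seq (testProg true) (testProg false))).eval
      (Function.update ρ 1 y) B)
    (fun y B => 3 + (when (cell 0 0 1) (seq (testProg true) (testProg false))).cost
      (Function.update ρ 1 y) B)
    -- A round without a test costs 3 for the loop, 6 for reading the entry and 2 for the branch.
    (HasGraph G) ?_ (fun y => 11 + if G.Adj (ρ 0) y then K else 0) ?_ n le_rfl A h.graph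
  · have hsum : ∑ y, (if G.Adj (ρ 0) y then K else 0) = G.degree (ρ 0) * K := by
      rw [← Finset.sum_filter, Finset.sum_const, SimpleGraph.degree,
        SimpleGraph.neighborFinset_eq_filter, smul_eq_mul]
    simp only [Fin.castLE_rfl, id_eq, Finset.sum_add_distrib, hsum, Finset.sum_const,
      Finset.card_univ, Fintype.card_fin, smul_eq_mul] at key
    rw [testsProg, Prog.cost]
    omega
  · intro y B hB
    exact hB.of_eq (eval_of_notMem_writes _ (by simp [testProg, clearProg, guessProg, spreadProg,
      spreadStep, writes]) _ _)
  · intro y B hB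
    have he : (cell 0 0 1).eval B (Function.update ρ 1 y) ≠ 0 ↔ G.Adj (ρ 0) y := by
      simp [Expr.eval, hB _ _]
    have := hcost (Function.update ρ 1 y) B
    simp only [Prog.cost, he] at this ⊢
    simp only [Expr.cost]
    split_ifs <;> omega

/-- Up to `n` start vertices, each with at most `D` neighbours, cause tests of cubic cost. The 1 in
`D + 1` absorbs the work outside the tests, such as reachability. -/
theorem mainProg_cost {A : Arrays n} (h : HasGraph G A) (h0 : ∀ k ≠ 0, ∀ i j, A k i j = false)
    (ρ : ℕ → Fin n) (D : ℕ) (hD : ∀ v, LocalMin G v → G.degree v ≤ D) :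
    mainProg.cost ρ A ≤ (reachProg.coeff + localMinExpr.coeff + 30 +
      (seq (testProg true) (testProg false)).coeff) * (n ^ 4 * (D + 1)) := by
  have hn := (ρ 0).pos
  set K := (seq (testProg true) (testProg false)).coeff
  have h1 : reachProg.cost ρ A ≤ reachProg.coeff * n ^ 4 := cost_le hn reachProg ρ A
  have h2 : localMinExpr.cost n ≤ localMinExpr.coeff * n ^ 2 := Expr.cost_le hn _
  have key := forCost_le
    (fun v B => (when localMinExpr testsProg).eval (Function.update ρ 0 v) B)
    (fun v B => 3 + (when localMinExpr testsProg).cost (Function.update ρ 0 v) B)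
    (Sound G) (fun v B hB => (componentStep_sound hB _).1)
    (fun v => 9 + localMinExpr.cost n + n * 12 + D * (K * n ^ 3)) ?_ n le_rfl _
    (reachProg_sound h h0 ρ)
  · simp only [Finset.sum_const, Finset.card_univ, Fintype.card_fin, smul_eq_mul] at key
    rw [mainProg, Prog.cost, Prog.cost]
    have e1 : 1 ≤ n ^ 4 := Nat.one_le_pow _ _ hn
    have e2 : n ≤ n ^ 4 := Nat.le_self_pow (by decide) n
    have e3 : n * n ≤ n ^ 4 := by
      rw [← pow_two]; exact Nat.pow_le_pow_right hn (by decide)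
    have e4 : n * n ^ 2 ≤ n ^ 4 := by
      rw [← pow_succ']; exact Nat.pow_le_pow_right hn (by decide)
    have e5 : n * (localMinExpr.cost n) ≤ localMinExpr.coeff * n ^ 4 := by
      calc n * localMinExpr.cost n ≤ n * (localMinExpr.coeff * n ^ 2) := Nat.mul_le_mul_left _ h2
        _ = localMinExpr.coeff * (n * n ^ 2) := by ring
        _ ≤ _ := Nat.mul_le_mul_left _ e4
    calc _ ≤ reachProg.coeff * n ^ 4 + (4 + (10 * n + n * localMinExpr.cost n + 12 * (n * n) +
          K * n ^ 4 * D)) := by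
          have : n * (1 + (9 + localMinExpr.cost n + n * 12 + D * (K * n ^ 3))) =
            10 * n + n * localMinExpr.cost n + 12 * (n * n) + K * n ^ 4 * D := by ring
          omega
      _ ≤ (reachProg.coeff + localMinExpr.coeff + 30) * n ^ 4 + K * n ^ 4 * D := by linarith
      _ ≤ _ := by
          have a1 := Nat.zero_le (K * n ^ 4)
          have a2 := Nat.zero_le ((reachProg.coeff + localMinExpr.coeff + 30) * n ^ 4 * D)
          linarith
  · intro v B hB
    have hv := hB.localMinExpr_eval (Function.update ρ 0 v)
    have hcost := testsProg_cost hB (Function.update ρ 0 v)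
    rw [Function.update_self] at hv hcost
    simp only [Prog.cost, hv]
    split_ifs with hl
    · have := Nat.mul_le_mul_right (K * n ^ 3) (hD v (hv.1 hl))
      change _ ≤ _ + _ * (K * n ^ 3) at hcost
      omega
    · omega

end Correctness

/-! ### Input, complete program and conclusion -/

open Classical in
/-- The arrays of the input. -/
noncomputable def inputArrays {n : ℕ} (G : SimpleGraph (Fin n)) : Arrays n :=
  fun k i j => decide (k = 0 ∧ G.Adj i j)

theorem represents_graphInput {n : ℕ} (hn : 0 < n) (G : SimpleGraph (Fin n)) :
    Represents (fun _ => ⟨0, hn⟩) (inputArrays G) (graphInput G) where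
  zero := rfl
  var x := by simp [graphInput]
  mem k i j := by
    have : (∃ i' j' : Fin n, G.Adj i' j' ∧ (k * n + i) * n + j = (i' : ℕ) * n + (j' : ℕ)) ↔
        k = 0 ∧ G.Adj i j := by
      have aux : ∀ i' j' : Fin n, (i' : ℕ) * n + (j' : ℕ) = (0 * n + i') * n + j' := by simp
      constructor
      · rintro ⟨i', j', h1, h2⟩
        rw [aux, address_inj] at h2
        obtain ⟨rfl, rfl, rfl⟩ := h2
        exact ⟨rfl, h1⟩
      · rintro ⟨rfl, h1⟩
        exact ⟨i, j, h1, (aux _ _).symm⟩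
    simp only [graphInput, inputArrays]
    by_cases h : k = 0 ∧ G.Adj i j
    · rw [if_pos (this.2 h)]; simp [h]
    · rw [if_neg (mt this.1 h)]; simp [h]

/-- Decides whether the input is the square of a graph of girth at least six. -/
def squareProgram : Program :=
  -- The graph without vertices is treated apart, since the variables of a matrix program need a
  -- vertex as value.
  .cond 0 (.seq (mainProg.compile 0) (.seq (answerExpr.compile 0) (.assign 0 (.copy (tmp 0)))))
    (.assign 0 (.const 1))

theorem squareProgram_reach {n : ℕ} (hn : 0 < n) (G : SimpleGraph (Fin n)) [DecidableRel G.Adj]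
    (D : ℕ) (hD : ∀ v, LocalMin G v → G.degree v ≤ D) :
    Reach ((n + 2) ^ (mainProg.width + answerExpr.width)) squareProgram (graphInput G)
      ((reachProg.coeff + localMinExpr.coeff + 32 + (seq (testProg true) (testProg false)).coeff +
        answerExpr.coeff) * (n ^ 4 * (D + 1)))
      fun s => s.reg 0 = 1 ∧ IsSquareOfGirthAtLeastSix G ∨
        s.reg 0 = 0 ∧ ¬ IsSquareOfGirthAtLeastSix G := by
  have hrep := represents_graphInput hn G
  have hG : HasGraph G (inputArrays G) := fun i j => by simp [inputArrays]
  have h0 : ∀ k ≠ 0, ∀ i j, inputArrays G k i j = false := fun k hk i j => by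
    simp [inputArrays, hk]
  obtain ⟨hs, hc⟩ := mainProg_spec hG h0 fun _ => ⟨0, hn⟩
  have hcost := mainProg_cost hG h0 (fun _ => ⟨0, hn⟩) D hD
  have hans : answerExpr.cost n ≤ answerExpr.coeff * n ^ 3 := Expr.cost_le hn _
  have hiff : IsSquareOfGirthAtLeastSix G ↔ ∀ v, LocalMin G v →
      mainProg.eval (fun _ => ⟨0, hn⟩) (inputArrays G) 3 v v = true := by
    rw [SimpleGraph.isSquareOfGirthAtLeastSix_iff]
    exact ⟨hc, hs.exists_isRoot⟩
  have hval := hs.answerExpr_eval fun _ => ⟨0, hn⟩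
  rw [← hiff] at hval
  have key : Reach ((n + 2) ^ (mainProg.width + answerExpr.width)) squareProgram (graphInput G)
      (1 + (mainProg.cost (fun _ => ⟨0, hn⟩) (inputArrays G) + (answerExpr.cost n + 1)))
      fun s => s.reg 0 = 1 ∧ IsSquareOfGirthAtLeastSix G ∨
        s.reg 0 = 0 ∧ ¬ IsSquareOfGirthAtLeastSix G := by
    refine .cond (fun _ => .seq <| (mainProg.compile_reach _ _ 0 ?_ _ hrep).mono le_rfl ?_)
      fun h => absurd h hn.ne'
    · exact Nat.pow_le_pow_right (by omega) (by omega)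
    · rintro s1 ⟨h1, -⟩
      refine .seq <| (answerExpr.compile_evaluates _ _ 0 ?_ s1 h1).mono le_rfl ?_
      · exact Nat.pow_le_pow_right (by omega) (by omega)
      · rintro s2 ⟨-, -, -, h2⟩
        have hv : (Operation.copy (tmp 0)).value s2 = answerExpr.eval
          (mainProg.eval (fun _ => ⟨0, hn⟩) (inputArrays G)) fun _ => ⟨0, hn⟩ := h2
        refine .assign ?_ ?_
        · have : 1 ≤ (n + 2) ^ (mainProg.width + answerExpr.width) := Nat.one_le_pow _ _ (by omega)
          rw [hv]
          omega
        · simpa [State.set_reg, hv] using hval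
  refine key.mono ?_ fun _ h => h
  have e1 : 1 ≤ n ^ 4 * (D + 1) := Nat.mul_pos (Nat.pow_pos hn) (by omega)
  have e2 : n ^ 3 ≤ n ^ 4 * (D + 1) :=
    (Nat.pow_le_pow_right hn (by decide)).trans (Nat.le_mul_of_pos_right _ (by omega))
  have e3 := Nat.mul_le_mul_left answerExpr.coeff e2
  linarith

end RAM

/-- One program decides, for every finite graph `G`, whether `G` is the square of a graph of girth
at least six. It uses words of `O(log n)` bits, runs in polynomial time on all graphs, and in time
`O(δ n ^ 4)` on connected graphs with at least two vertices. -/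
theorem mainTheorem3 :
    ∃ (p : RAM.Program) (c C : ℕ), ∀ (n : ℕ) (G : SimpleGraph (Fin n)) [DecidableRel G.Adj],
      ∃ t : ℕ, RAM.AnswersIn ((n + 2) ^ c) p G (IsSquareOfGirthAtLeastSix G) t ∧
        t ≤ C * (n ^ 5 + 1) ∧
        (G.Connected → 2 ≤ n → t ≤ C * (G.minDegree * n ^ 4)) := by
  obtain ⟨K, hK⟩ : ∃ K, K = RAM.reachProg.coeff + RAM.localMinExpr.coeff + 32 +
    (RAM.Prog.seq (RAM.testProg true) (RAM.testProg false)).coeff + RAM.answerExpr.coeff := ⟨_, rfl⟩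
  -- The factor 2 comes from `δ + 1 ≤ 2 * δ`, valid for connected graphs with at least two vertices.
  -- In the remaining nonempty cases `D = n - 1` serves, and `D + 1 = n` gives `n ^ 5`.
  refine ⟨RAM.squareProgram, RAM.mainProg.width + RAM.answerExpr.width, 2 * K, fun n G _ => ?_⟩
  rcases Nat.eq_zero_or_pos n with rfl | hn
  · refine ⟨2, ⟨_, .cond_zero rfl (.assign _ _ _ ?_), .inl ⟨?_, ?_⟩⟩, by omega, by omega⟩
    · exact Nat.one_le_pow _ _ (by omega)
    · simp [RAM.Operation.value]
    · rw [SimpleGraph.isSquareOfGirthAtLeastSix_iff]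
      exact ⟨⊥, ⟨fun h => h.elim, fun _ _ h => h.elim, fun h => h.elim⟩, fun a => a.elim0⟩
  · by_cases hconn : G.Connected ∧ 2 ≤ n
    · obtain ⟨hc, h2⟩ := hconn
      have : Nontrivial (Fin n) := Fin.nontrivial_iff_two_le.2 h2
      have : Nonempty (Fin n) := ⟨⟨0, hn⟩⟩
      have hpos : 0 < G.minDegree := hc.preconnected.minDegree_pos_of_nontrivial
      obtain ⟨t, s, hr, ht, hs⟩ := RAM.squareProgram_reach hn G G.minDegree fun v hv => by
        obtain ⟨u, hu⟩ := G.exists_minimal_degree_vertex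
        rw [hu]
        exact hv.2 u (hc.preconnected v u)
      rw [← hK] at ht
      have hle : t ≤ 2 * K * (G.minDegree * n ^ 4) := by
        refine ht.trans ?_
        calc K * (n ^ 4 * (G.minDegree + 1)) ≤ K * (n ^ 4 * (2 * G.minDegree)) := by gcongr; omega
          _ = _ := by ring
      refine ⟨t, ⟨s, hr, hs⟩, hle.trans ?_, fun _ _ => hle⟩
      have hlt : G.minDegree ≤ n := by
        obtain ⟨u, hu⟩ := G.exists_minimal_degree_vertex
        have := G.degree_lt_card_verts u
        rw [Fintype.card_fin] at this
        omega
      refine Nat.mul_le_mul_left _ ?_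
      calc G.minDegree * n ^ 4 ≤ n * n ^ 4 := Nat.mul_le_mul_right _ hlt
        _ ≤ n ^ 5 + 1 := by rw [← pow_succ']; exact Nat.le_succ _
    · obtain ⟨t, s, hr, ht, hs⟩ := RAM.squareProgram_reach hn G (n - 1) fun v _ => by
        have := G.degree_lt_card_verts v
        rw [Fintype.card_fin] at this
        omega
      rw [← hK, Nat.sub_add_cancel hn, ← pow_succ] at ht
      refine ⟨t, ⟨s, hr, hs⟩, ?_, fun h1 h2 => absurd ⟨h1, h2⟩ hconn⟩
      calc t ≤ K * n ^ 5 := ht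
        _ ≤ _ := Nat.mul_le_mul (by omega) (by omega)
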